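/- Let $1\le m\le n$ and let $M$ be a nonempty smooth compact (Hausdorff) manifold of dimension $m$, possibly with boundary. Let $\Omega^1(M,\mathbb R^n)$ be the space of smooth $\mathbb R^n$-valued one-forms on $M$, and let $\Omega^1_+(M,\mathbb R^n)$ be the open subset of full-ranked one-forms, i.e. those $\alpha$ for which $\alpha(x):T_xM\to\mathbb R^n$ is injective for all $x\in M$; assume it is nonempty. Equip $\Omega^1_+(M,\mathbb R^n)$ with the generalized Ebin metric $$G_\alpha(\zeta,\eta)=\int_M \operatorname{tr}\bigl(\zeta_x(\alpha^T\alpha)_x^{-1}\eta_x^T\bigr)\sqrt{\det(\alpha^T\alpha)_x}\,dx,\qquad \zeta,\eta\in T_\alpha\Omega^1_+(M,\mathbb R^n)=\Omega^1(M,\mathbb R^n).$$ Geodesics are the smooth curves in $\Omega^1_+(M,\mathbb R^n)$ that, on each compact subinterval $[a,b]$, are critical points of the energy $\int_a^b G_\gamma(\gamma',\gamma')\,dt$ under smooth variations with fixed endpoints. The geodesic distance is the infimum of the lengths $\int_0^1\sqrt{G_\gamma(\gamma',\gamma')}\,dt$ of piecewise smooth paths in $\Omega^1_+(M,\mathbb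 R^n)$ joining two points ($\infty$ if there are none). Theorem. The space $\Omega^1_+(M,\mathbb R^n)$ with the generalized Ebin metric is 1. geodesically incomplete: there is a geodesic, defined on an open interval, that is not the restriction of a geodesic defined on all of $\mathbb R$; 2. metrically incomplete: there is a sequence in $\Omega^1_+(M,\mathbb R^n)$ that is Cauchy for the geodesic distance but does not converge, in the geodesic distance, to any element of $\Omega^1_+(M,\mathbb R^n)$. 3. Moreover, scaling geodesics leave the space in finite time: for every $\alpha\in\Omega^1_+(M,\mathbb R^n)$ and every $c<0$, put $T=\frac{2}{|c|m}$ and $\gamma(t)=\bigl(1+\tfrac{cm}{2}t\bigr)^{2/m}\alpha$. Then $\gamma$ is a geodesic in $\Omega^1_+(M,\mathbb R^n)$ on $(-\infty,T)$ with $\gamma(0)=\alpha$ and $\gamma'(0)=c\,\alpha$; it satisfies $\gamma(t)(x)v\to 0$ as $t\uparrow T$ for all $x\in M$ and $v\in T_xM$; and for no $b>T$ is there a geodesic on $[0,b)$ that agrees with $\gamma$ on $[0,T)$. -/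

import Mathlib

open Set Filter Topology Bundle MeasureTheory
open scoped Manifold ContDiff Matrix ENNReal

noncomputable section

namespace EbinForms

section MatrixMetric

variable {m n : ℕ}

/-- The Riemannian metric `⟨u, v⟩_a = tr (u (aᵀ a)⁻¹ vᵀ) √(det (aᵀ a))` on the space of full rank
`n × m` matrices. -/
def matrixMetric (a u v : Matrix (Fin n) (Fin m) ℝ) : ℝ :=
  Matrix.trace (u * (aᵀ * a)⁻¹ * vᵀ) * Real.sqrt (Matrix.det (aᵀ * a))

end MatrixMetric

section Manifold

variable {m : ℕ} {H : Type*} [TopologicalSpace H]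
  (I : ModelWithCorners ℝ (EuclideanSpace ℝ (Fin m)) H)
  (M : Type*) [TopologicalSpace M] [ChartedSpace H M] [IsManifold I ∞ M] (n : ℕ)

/-- The bundle over `M` whose fibre at `x` is the space of linear maps `T_x M → ℝⁿ`. -/
abbrev FormFibre (x : M) : Type _ :=
  TangentSpace I x →L[ℝ] Bundle.Trivial M (EuclideanSpace ℝ (Fin n)) x

/-- `Ω¹(M, ℝⁿ)`: smooth `ℝⁿ`-valued one-forms, i.e. smooth sections of `Hom(TM, ℝⁿ)`. -/
abbrev OneForm : Type _ :=
  ContMDiffSection I (EuclideanSpace ℝ (Fin m) →L[ℝ] EuclideanSpace ℝ (Fin n)) ∞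
    (FormFibre I M n)

instance : AddCommGroup (OneForm I M n) := ContMDiffSection.instAddCommGroup

instance : Module ℝ (OneForm I M n) := ContMDiffSection.instModule

/-- `Ω¹₊(M, ℝⁿ)`: the one-forms `α` such that `α x` is injective for every `x`. -/
def fullRank : Set (OneForm I M n) := {α | ∀ x, Function.Injective (α x)}

variable {M n}

/-- The coordinate expression, at the point with coordinates `y` in the chart around `i`, of a
field `ζ` of linear maps `T_x M → ℝⁿ`: the `n × m` matrix whose `j`-th column is `ζ(∂/∂xʲ)`. -/
def coordMatrix (i : M) (y : EuclideanSpace ℝ (Fin m)) (ζ : ∀ x, FormFibre I M n x) :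
    Matrix (Fin n) (Fin m) ℝ :=
  Matrix.of fun k j =>
    (show EuclideanSpace ℝ (Fin n) from
      ζ ((extChartAt I i).symm y)
        (mfderivWithin 𝓘(ℝ, EuclideanSpace ℝ (Fin m)) I (extChartAt I i).symm (range I) y
          (EuclideanSpace.single j (1 : ℝ)))) k

variable (M)

/-- A smooth partition of unity on `M` subordinate to the atlas of preferred charts. -/
def chartPartition [T2Space M] [SigmaCompactSpace M] : SmoothPartitionOfUnity M I M univ :=
  Classical.choose (SmoothPartitionOfUnity.exists_isSubordinate_chartAt_source I M)

theorem chartPartition_isSubordinate [T2Space M] [SigmaCompactSpace M] :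
    (chartPartition I M).IsSubordinate (fun x => (chartAt H x).source) :=
  Classical.choose_spec (SmoothPartitionOfUnity.exists_isSubordinate_chartAt_source I M)

variable {M}

/-- The generalized Ebin metric
`G_α(ζ, η) = ∫_M (αᵀα)⁻¹(ζ, η) vol(α) = ∫_M tr (ζ (αᵀα)⁻¹ ηᵀ) √(det (αᵀα)) dx`.
The integrand is a density on `M`; it is integrated in the usual way, by means of a partition of
unity subordinate to an atlas and of Lebesgue integrals in the charts. -/
def ebinMetric [T2Space M] [SigmaCompactSpace M] (α ζ η : ∀ x, FormFibre I M n x) : ℝ :=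
  ∑ᶠ i : M, ∫ y in (extChartAt I i).target,
    chartPartition I M i ((extChartAt I i).symm y) *
      matrixMetric (coordMatrix I i y α) (coordMatrix I i y ζ) (coordMatrix I i y η)

/-- Smoothness on `J` of a curve of one-forms, as a curve in the Fréchet space `Ω¹(M, ℝⁿ)`: the
map `(t, x) ↦ γ t x` is smooth on `J × M`. -/
def SmoothCurveOn (γ : ℝ → OneForm I M n) (J : Set ℝ) : Prop :=
  ContMDiffOn (𝓘(ℝ, ℝ).prod I)
    (I.prod 𝓘(ℝ, EuclideanSpace ℝ (Fin m) →L[ℝ] EuclideanSpace ℝ (Fin n))) ∞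
    (fun p : ℝ × M =>
      (TotalSpace.mk' (EuclideanSpace ℝ (Fin m) →L[ℝ] EuclideanSpace ℝ (Fin n)) p.2 (γ p.1 p.2) :
        TotalSpace (EuclideanSpace ℝ (Fin m) →L[ℝ] EuclideanSpace ℝ (Fin n)) (FormFibre I M n)))
    (J ×ˢ univ)

variable {I}

/-- The velocity `γ'(t)` of a curve of one-forms, computed in each fibre. -/
def velocity (γ : ℝ → OneForm I M n) (t : ℝ) : ∀ x, FormFibre I M n x :=
  fun x => deriv (fun τ => γ τ x) t

variable [T2Space M] [SigmaCompactSpace M]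

/-- The energy `∫_a^b G_γ(γ', γ') dt` of a curve of one-forms. -/
def energy (γ : ℝ → OneForm I M n) (a b : ℝ) : ℝ :=
  ∫ t in a..b, ebinMetric I (fun x => γ t x) (velocity γ t) (velocity γ t)

/-- The length `∫_a^b √(G_γ(γ', γ')) dt` of a curve of one-forms. -/
def length (γ : ℝ → OneForm I M n) (a b : ℝ) : ℝ :=
  ∫ t in a..b, Real.sqrt (ebinMetric I (fun x => γ t x) (velocity γ t) (velocity γ t))

/-- `γ` restricted to `J` is a geodesic of `Ω¹₊(M, ℝⁿ)`: a smooth curve in `Ω¹₊(M, ℝⁿ)` that is,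
on each compact subinterval of `J`, a critical point of the energy: the directional derivative of
the energy vanishes for every smooth variation field `h` that vanishes at the endpoints. -/
structure IsGeodesicOn (γ : ℝ → OneForm I M n) (J : Set ℝ) : Prop where
  smooth : SmoothCurveOn I γ J
  mem_fullRank : ∀ t ∈ J, γ t ∈ fullRank I M n
  critical : ∀ a b : ℝ, a < b → Icc a b ⊆ J → ∀ h : ℝ → OneForm I M n,
    SmoothCurveOn I h (Icc a b) → h a = 0 → h b = 0 →
      HasDerivAt (fun s : ℝ => energy (fun t => γ t + s • h t) a b) 0 0

variable (I M n)

/-- Geodesic completeness of `Ω¹₊(M, ℝⁿ)`: every geodesic, defined on some open interval, is the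
restriction of a geodesic that is defined for all times. -/
def GeodesicallyComplete : Prop :=
  ∀ (J : Set ℝ) (γ : ℝ → OneForm I M n), IsOpen J → J.OrdConnected → IsGeodesicOn γ J →
    ∃ σ : ℝ → OneForm I M n, IsGeodesicOn σ univ ∧ EqOn σ γ J

variable {I M n}

/-- `γ` restricted to `[0, 1]` is a piecewise smooth path in `Ω¹₊(M, ℝⁿ)` from `α` to `β`. -/
structure IsPath (γ : ℝ → OneForm I M n) (α β : OneForm I M n) : Prop where
  mem_fullRank : ∀ t ∈ Icc (0 : ℝ) 1, γ t ∈ fullRank I M n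
  piecewise_smooth : ∃ (k : ℕ) (p : ℕ → ℝ), Monotone p ∧ p 0 = 0 ∧ p k = 1 ∧
    ∀ i < k, SmoothCurveOn I γ (Icc (p i) (p (i + 1)))
  source : γ 0 = α
  target : γ 1 = β

/-- The geodesic distance: the infimum of the lengths of the paths in `Ω¹₊(M, ℝⁿ)` from `α` to `β`
(it is `∞` if there is no such path). -/
def geodesicDist (α β : OneForm I M n) : ℝ≥0∞ :=
  ⨅ (γ : ℝ → OneForm I M n) (_ : IsPath γ α β), ENNReal.ofReal (length γ 0 1)

variable (I M n)

/-- Metric completeness of `Ω¹₊(M, ℝⁿ)`: every sequence that is Cauchy with respect to the geodesic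
distance converges to an element of `Ω¹₊(M, ℝⁿ)` with respect to the geodesic distance. -/
def MetricallyComplete : Prop :=
  ∀ u : ℕ → OneForm I M n, (∀ k, u k ∈ fullRank I M n) →
    (∀ ε : ℝ≥0∞, 0 < ε → ∃ N, ∀ k ≥ N, ∀ l ≥ N, geodesicDist (u k) (u l) < ε) →
    ∃ β ∈ fullRank I M n, Tendsto (fun k => geodesicDist (u k) β) atTop (𝓝 0)

variable {I M n}

/-- The scaling curve `t ↦ (1 + c m t / 2)^(2/m) α`. -/
def scalingCurve (α : OneForm I M n) (c : ℝ) (t : ℝ) : OneForm I M n :=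
  ((1 + c * m * t / 2) ^ (2 / (m : ℝ)) : ℝ) • α

end Manifold

end EbinForms

end

/-! Everything rests on the homogeneity of the metric along a ray: for `f > 0` and a full-ranked
`α`, `G_{fα}(gα, gα) = f ^ (m - 2) * g ^ 2 * G_α(α, α)`. With `ρ = f ^ (m / 2)` this is a constant
times `ρ' ^ 2` along `f α`, so `ρ` is an affine parameter of the ray and the zero form lies at
finite distance, at `ρ = 0`.

Rays with `ρ = r + q t` are geodesics of the whole space, not only of the ray. The energy density
contains no derivatives along `M`, so the first variation splits into a time integral at each point
of a chart. There the integrand is the exact derivative of a multiple of `(ρ / f) * tr (A (Aᵀ A)⁻¹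
Bᵀ)`, where `B` is the variation, and the boundary terms vanish (`hasDerivAt_energy`,
`integral_variation_powerCurve_eq_zero`, `isGeodesicOn_powerCurve`).

A geodesic extending a shrinking ray past `ρ = 0` would by continuity take the value `0` in a fibre
of positive dimension, which is not injective (`not_isGeodesicOn_of_eqOn_scalingCurve`). This gives
geodesic incompleteness.

For metric incompleteness, forms on one ray with `ρ → 0` are Cauchy, since the ray bounds their
distances (`geodesicDist_powerCurve_le`). A limit is excluded by volume: by Cauchy-Schwarz, twice,
the square root of the volume grows by at most `√m / 2` times the length of a path
(`sqrt_chartVolume_sub_le`). The volumes along the sequence tend to `0`, while every full-ranked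
form has positive volume. The volume weighted by one function of the partition suffices, so no
change of charts is needed. -/

noncomputable section

namespace EbinForms

/-! ### One-forms read in the preferred trivializations -/

section Coordinates

variable {m : ℕ} {H : Type*} [TopologicalSpace H]
  {I : ModelWithCorners ℝ (EuclideanSpace ℝ (Fin m)) H}
  {M : Type*} [TopologicalSpace M] [ChartedSpace H M] [IsManifold I ∞ M] {n : ℕ}

/-- The linear map with given matrix columns, as a matrix. -/
def columns : (EuclideanSpace ℝ (Fin m) →L[ℝ] EuclideanSpace ℝ (Fin n)) →ₗ[ℝ]
    Matrix (Fin n) (Fin m) ℝ where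
  toFun B := Matrix.of fun k j => B (EuclideanSpace.single j 1) k
  map_add' _ _ := rfl
  map_smul' _ _ := rfl

variable (I) in
/-- A linear map on `T_x M`, read in the preferred trivialization at `i`. -/
def localForm (i x : M) : FormFibre I M n x →ₗ[ℝ]
    (EuclideanSpace ℝ (Fin m) →L[ℝ] EuclideanSpace ℝ (Fin n)) where
  toFun B := ContinuousLinearMap.comp (show TangentSpace I x →L[ℝ] EuclideanSpace ℝ (Fin n) from B)
    ((trivializationAt (EuclideanSpace ℝ (Fin m)) (TangentSpace I) i).symmL ℝ x)
  map_add' _ _ := rfl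
  map_smul' _ _ := rfl

/-- The derivative of the inverse chart is the inverse of the tangent trivialization. This links the
coordinate matrices of the metric to the trivialization in which smoothness of sections is
expressed. -/
theorem coordMatrix_eq_columns (i : M) {y : EuclideanSpace ℝ (Fin m)}
    (hy : y ∈ (extChartAt I i).target) (ζ : ∀ x, FormFibre I M n x) :
    coordMatrix I i y ζ =
      columns (localForm I i ((extChartAt I i).symm y) (ζ ((extChartAt I i).symm y))) := by
  have hx : (extChartAt I i).symm y ∈ (chartAt H i).source := by
    rw [← extChartAt_source I]; exact (extChartAt I i).map_target hy
  have := TangentBundle.symmL_trivializationAt (I := I) hx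
  rw [(extChartAt I i).right_inv hy] at this
  ext k j
  exact congrArg (fun Φ : EuclideanSpace ℝ (Fin m) →L[ℝ] TangentSpace I ((extChartAt I i).symm y) =>
    (show EuclideanSpace ℝ (Fin n) from
      ζ ((extChartAt I i).symm y) (Φ (EuclideanSpace.single j 1))) k) this.symm

theorem trivialization_apply_eq_localForm (i x : M) (B : FormFibre I M n x)
    : (trivializationAt (EuclideanSpace ℝ (Fin m) →L[ℝ] EuclideanSpace ℝ (Fin n))
      (FormFibre I M n) i ⟨x, B⟩).2 = localForm I i x B := by
  rw [hom_trivializationAt_apply]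
  ext v k
  simp only [ContinuousLinearMap.inCoordinates, ContinuousLinearMap.comp_apply]
  simp
  rfl

variable (I) in
/-- The inverse of `localForm` over the chart domain. -/
def ofLocalForm (i x : M) :
    (EuclideanSpace ℝ (Fin m) →L[ℝ] EuclideanSpace ℝ (Fin n)) →L[ℝ] FormFibre I M n x :=
  (ContinuousLinearMap.compL ℝ (EuclideanSpace ℝ (Fin m)) (EuclideanSpace ℝ (Fin m))
    (EuclideanSpace ℝ (Fin n))).flip
    ((trivializationAt (EuclideanSpace ℝ (Fin m)) (TangentSpace I) i).continuousLinearMapAt ℝ x)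

theorem ofLocalForm_localForm {i x : M} (hx : x ∈ (chartAt H i).source) (B : FormFibre I M n x) :
    ofLocalForm I i x (localForm I i x B) = B := by
  ext v k
  have := (trivializationAt (EuclideanSpace ℝ (Fin m)) (TangentSpace I) i).symmL_continuousLinearMapAt
    (R := ℝ) (b := x) (by simpa using hx) v
  change (B ((trivializationAt (EuclideanSpace ℝ (Fin m)) (TangentSpace I) i).symmL ℝ x
    ((trivializationAt (EuclideanSpace ℝ (Fin m)) (TangentSpace I) i).continuousLinearMapAt ℝ x v))
    ) k = B v k
  rw [this]

theorem localForm_ofLocalForm {i x : M} (hx : x ∈ (chartAt H i).source)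
    (B : EuclideanSpace ℝ (Fin m) →L[ℝ] EuclideanSpace ℝ (Fin n)) :
    localForm I i x (ofLocalForm I i x B) = B := by
  ext v k
  have := (trivializationAt (EuclideanSpace ℝ (Fin m)) (TangentSpace I) i).continuousLinearMapAt_symmL
    (R := ℝ) (b := x) (by simpa using hx) v
  change (B ((trivializationAt (EuclideanSpace ℝ (Fin m)) (TangentSpace I) i).continuousLinearMapAt ℝ x
    ((trivializationAt (EuclideanSpace ℝ (Fin m)) (TangentSpace I) i).symmL ℝ x v))
    ) k = B v k
  rw [this]

/-- Bundle smoothness becomes ordinary smoothness of a map between vector spaces, including at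
boundary points of the chart. All later regularity of coordinate matrices comes from here. -/
theorem SmoothCurveOn.contDiffOn_localForm {γ : ℝ → OneForm I M n} {J : Set ℝ}
    (hγ : SmoothCurveOn I γ J) (i : M) :
    ContDiffOn ℝ ∞ (fun p : ℝ × EuclideanSpace ℝ (Fin m) =>
      localForm I i ((extChartAt I i).symm p.2) (γ p.1 ((extChartAt I i).symm p.2)))
      (J ×ˢ (extChartAt I i).target) := by
  have h1 := hγ.mono (prod_mono_right (subset_univ (chartAt H i).source))
  rw [Trivialization.contMDiffOn_iff
    (e := trivializationAt (EuclideanSpace ℝ (Fin m) →L[ℝ] EuclideanSpace ℝ (Fin n))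
      (FormFibre I M n) i)] at h1
  · have h2 := h1.2
    simp only [trivialization_apply_eq_localForm] at h2
    have h3 : ContMDiffOn 𝓘(ℝ, ℝ × EuclideanSpace ℝ (Fin m)) (𝓘(ℝ, ℝ).prod I) ∞
        (fun p : ℝ × EuclideanSpace ℝ (Fin m) => (p.1, (extChartAt I i).symm p.2))
        (J ×ˢ (extChartAt I i).target) := by
      refine ContMDiffOn.prodMk contDiff_fst.contMDiff.contMDiffOn ?_
      exact (contMDiffOn_extChartAt_symm i).comp contDiff_snd.contMDiff.contMDiffOn
        (fun p hp => hp.2)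
    have h4 := h2.comp h3 (fun p hp => ⟨hp.1, by
      rw [← extChartAt_source I]; exact (extChartAt I i).map_target hp.2⟩)
    exact h4.contDiffOn
  · intro p hp
    rw [Trivialization.mem_source]
    simpa using hp.2

end Coordinates

/-! ### Derivatives of determinant and inverse -/

section MatrixCalculus

attribute [local instance] Matrix.normedAddCommGroup Matrix.normedSpace

variable {l m n : ℕ}

theorem hasDerivAt_matrix_iff {A : ℝ → Matrix (Fin n) (Fin m) ℝ} {A' : Matrix (Fin n) (Fin m) ℝ}
    {s : ℝ} : HasDerivAt A A' s ↔ ∀ i j, HasDerivAt (fun r => A r i j) (A' i j) s :=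
  (hasDerivAt_pi (φ := A) (φ' := A')).trans (forall_congr' fun _ => hasDerivAt_pi)

theorem hasDerivAt_matrix_mul {A : ℝ → Matrix (Fin n) (Fin m) ℝ} {A' : Matrix (Fin n) (Fin m) ℝ}
    {B : ℝ → Matrix (Fin m) (Fin l) ℝ} {B' : Matrix (Fin m) (Fin l) ℝ} {s : ℝ}
    (hA : HasDerivAt A A' s) (hB : HasDerivAt B B' s) :
    HasDerivAt (fun r => A r * B r) (A' * B s + A s * B') s := by
  rw [hasDerivAt_matrix_iff] at *
  intro i j
  simp only [Matrix.mul_apply, Matrix.add_apply, ← Finset.sum_add_distrib]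
  exact HasDerivAt.fun_sum fun k _ => (hA i k).mul (hB k j)

theorem hasDerivAt_matrix_transpose {A : ℝ → Matrix (Fin n) (Fin m) ℝ}
    {A' : Matrix (Fin n) (Fin m) ℝ} {s : ℝ} (hA : HasDerivAt A A' s) :
    HasDerivAt (fun r => (A r)ᵀ) A'ᵀ s := by
  rw [hasDerivAt_matrix_iff] at *
  exact fun i j => hA j i

theorem hasDerivAt_matrix_trace {A : ℝ → Matrix (Fin n) (Fin n) ℝ}
    {A' : Matrix (Fin n) (Fin n) ℝ} {s : ℝ} (hA : HasDerivAt A A' s) :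
    HasDerivAt (fun r => (A r).trace) A'.trace s := by
  rw [hasDerivAt_matrix_iff] at hA
  exact HasDerivAt.fun_sum fun i _ => hA i i

theorem contDiff_matrix_det :
    ContDiff ℝ ∞ (fun A : Matrix (Fin m) (Fin m) ℝ => A.det) := by
  simp only [Matrix.det_apply']
  have h : ∀ i j, ContDiff ℝ ∞ (fun A : Matrix (Fin m) (Fin m) ℝ => A i j) := fun i j =>
    contDiff_pi.1 (contDiff_pi.1 contDiff_id i) j
  exact ContDiff.sum fun σ _ => contDiff_const.mul (contDiff_prod fun i _ => h _ _)

/-- Jacobi's formula at an invertible matrix. -/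
theorem hasDerivAt_matrix_det {A : ℝ → Matrix (Fin m) (Fin m) ℝ}
    {A' : Matrix (Fin m) (Fin m) ℝ} {s : ℝ} (hA : HasDerivAt A A' s) (h0 : (A s).det ≠ 0) :
    HasDerivAt (fun r => (A r).det) ((A s).det * ((A s)⁻¹ * A').trace) s := by
  have hd : DifferentiableAt ℝ (fun A : Matrix (Fin m) (Fin m) ℝ => A.det) (A s) :=
    contDiff_matrix_det.contDiffAt.differentiableAt (by simp)
  have h1 := hd.hasFDerivAt.comp_hasDerivAt s hA
  -- The determinant is differentiable, so its derivative in the direction `A'` may be computed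
  -- along a straight line, where `det (1 + r X) = 1 + r tr X + O(r ^ 2)`.
  have hline : HasDerivAt (fun r : ℝ => A s + r • A') A' 0 := by
    rw [hasDerivAt_matrix_iff]
    intro i j
    simpa using ((hasDerivAt_id (0 : ℝ)).mul_const (A' i j)).const_add (A s i j)
  have h2 : HasDerivAt (fun r : ℝ => (A s + r • A').det)
      (fderiv ℝ (fun A : Matrix (Fin m) (Fin m) ℝ => A.det) (A s) A') 0 := by
    have hd' : HasFDerivAt (fun A : Matrix (Fin m) (Fin m) ℝ => A.det)
      (fderiv ℝ (fun A : Matrix (Fin m) (Fin m) ℝ => A.det) (A s)) (A s + (0 : ℝ) • A') := by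
      simpa using hd.hasFDerivAt
    exact hd'.comp_hasDerivAt (0 : ℝ) hline
  have h3 : HasDerivAt (fun r : ℝ => (A s + r • A').det)
      ((A s).det * ((A s)⁻¹ * A').trace) 0 := by
    have e : ∀ r : ℝ, (A s + r • A').det = (A s).det * (1 + r • ((A s)⁻¹ * A')).det := by
      intro r
      rw [← Matrix.det_mul, mul_add, mul_one, mul_smul_comm,
        Matrix.mul_nonsing_inv_cancel_left _ _ (isUnit_iff_ne_zero.2 h0)]
    simp_rw [e, fun r : ℝ => Matrix.det_one_add_smul r ((A s)⁻¹ * A')]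
    refine HasDerivAt.const_mul _ ?_
    have h4 := ((hasDerivAt_const (0 : ℝ) (1 : ℝ)).add
      ((hasDerivAt_id (0 : ℝ)).const_mul ((A s)⁻¹ * A').trace)).add
      (((Polynomial.hasDerivAt
        (Matrix.det (1 + (Polynomial.X : Polynomial ℝ) •
          ((A s)⁻¹ * A').map Polynomial.C)).divX.divX (0 : ℝ))).mul
        ((hasDerivAt_id (0 : ℝ)).pow 2))
    exact h4.congr_deriv (by simp)
  rw [← h2.unique h3]
  exact h1

/-- Differentiability comes from the adjugate formula; the value of the derivative is then forced by
differentiating `A * A⁻¹ = 1`. -/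
theorem hasDerivAt_matrix_inv {A : ℝ → Matrix (Fin m) (Fin m) ℝ}
    {A' : Matrix (Fin m) (Fin m) ℝ} {s : ℝ} (hA : HasDerivAt A A' s) (h0 : (A s).det ≠ 0) :
    HasDerivAt (fun r => (A r)⁻¹) (-((A s)⁻¹ * A' * (A s)⁻¹)) s := by
  obtain ⟨D, h1⟩ : ∃ D, HasDerivAt (fun r => (A r)⁻¹) D s := by
    have : ∀ i j, DifferentiableAt ℝ (fun r => (A r)⁻¹ i j) s := by
      intro i j
      simp only [Matrix.inv_def, Ring.inverse_eq_inv', Matrix.smul_apply, smul_eq_mul,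
        Matrix.adjugate_apply]
      refine ((hasDerivAt_matrix_det hA h0).differentiableAt.inv h0).mul ?_
      refine (contDiff_matrix_det.contDiffAt.differentiableAt (by simp)).comp
        (f := fun r => (A r).updateRow j (Pi.single i 1)) s ?_
      refine differentiableAt_pi.2 fun a => differentiableAt_pi.2 fun b => ?_
      simp only [Matrix.updateRow_apply]
      split_ifs
      · exact differentiableAt_const _
      · exact (hasDerivAt_matrix_iff.1 hA a b).differentiableAt
    exact ⟨Matrix.of fun i j => deriv (fun r => (A r)⁻¹ i j) s,
      hasDerivAt_matrix_iff.2 fun i j => (this i j).hasDerivAt⟩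
  have h2 := hasDerivAt_matrix_mul hA h1
  have hev : ∀ᶠ r in 𝓝 s, (A r).det ≠ 0 :=
    (hasDerivAt_matrix_det hA h0).continuousAt.eventually_ne h0
  have h3 : HasDerivAt (fun r => A r * (A r)⁻¹) 0 s :=
    (hasDerivAt_const s (1 : Matrix (Fin m) (Fin m) ℝ)).congr_of_eventuallyEq <| by
      filter_upwards [hev] with r hr
      exact Matrix.mul_nonsing_inv _ (isUnit_iff_ne_zero.2 hr)
  have h4 : A' * (A s)⁻¹ + A s * D = 0 := h2.unique h3
  have h5 : D = -((A s)⁻¹ * A' * (A s)⁻¹) := by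
    rw [← Matrix.nonsing_inv_mul_cancel_left (A s) D
      (isUnit_iff_ne_zero.2 h0), eq_neg_of_add_eq_zero_right h4]
    simp [mul_assoc]
  rwa [h5] at h1

theorem continuousOn_matrix_inv {X : Type*} [TopologicalSpace X] {S : Set X}
    {A : X → Matrix (Fin m) (Fin m) ℝ} (hA : ContinuousOn A S) (h0 : ∀ x ∈ S, (A x).det ≠ 0) :
    ContinuousOn (fun x => (A x)⁻¹) S := by
  simp only [Matrix.inv_def, Ring.inverse_eq_inv']
  have h1 : Continuous (fun A : Matrix (Fin m) (Fin m) ℝ => A.det) := continuous_id.matrix_det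
  have h2 : Continuous (fun A : Matrix (Fin m) (Fin m) ℝ => A.adjugate) :=
    continuous_id.matrix_adjugate
  exact ((h1.comp_continuousOn hA).inv₀ h0).smul (h2.comp_continuousOn hA)

end MatrixCalculus

/-! ### The pointwise energy density: scaling, first variation, continuity -/

section LagrangianCalculus

attribute [local instance] Matrix.normedAddCommGroup Matrix.normedSpace

variable {m n : ℕ}

/-- The pairing `tr (u (aᵀ a)⁻¹ vᵀ)`. -/
def gramPairing (a u v : Matrix (Fin n) (Fin m) ℝ) : ℝ :=
  Matrix.trace (u * (aᵀ * a)⁻¹ * vᵀ)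

/-- The volume density `√(det (aᵀ a))`. -/
def gramDensity (a : Matrix (Fin n) (Fin m) ℝ) : ℝ :=
  Real.sqrt (Matrix.det (aᵀ * a))

theorem matrixMetric_eq (a u v : Matrix (Fin n) (Fin m) ℝ) :
    matrixMetric a u v = gramPairing a u v * gramDensity a := rfl

theorem gram_inv_transpose (a : Matrix (Fin n) (Fin m) ℝ) :
    ((aᵀ * a)⁻¹)ᵀ = (aᵀ * a)⁻¹ := by
  rw [Matrix.transpose_nonsing_inv, Matrix.transpose_mul, Matrix.transpose_transpose]

theorem gramPairing_comm (a u v : Matrix (Fin n) (Fin m) ℝ) :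
    gramPairing a u v = gramPairing a v u := by
  rw [gramPairing, ← Matrix.trace_transpose, Matrix.transpose_mul, Matrix.transpose_mul,
    gram_inv_transpose, Matrix.transpose_transpose, ← Matrix.mul_assoc, gramPairing]

/-- The Gram matrix is positive semidefinite and so is its `⁻¹`, even when it is singular; hence no
rank condition on `a`. -/
theorem gramPairing_self_nonneg (a v : Matrix (Fin n) (Fin m) ℝ) : 0 ≤ gramPairing a v v := by
  have h1 : (aᵀ * a).PosSemidef := by
    simpa using Matrix.posSemidef_conjTranspose_mul_self a
  exact (h1.inv.mul_mul_conjTranspose_same v).trace_nonneg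

theorem gramDensity_nonneg (a : Matrix (Fin n) (Fin m) ℝ) : 0 ≤ gramDensity a := Real.sqrt_nonneg _

theorem matrixMetric_self_nonneg (a v : Matrix (Fin n) (Fin m) ℝ) : 0 ≤ matrixMetric a v v :=
  mul_nonneg (gramPairing_self_nonneg a v) (gramDensity_nonneg a)

theorem gramPairing_base_self {a : Matrix (Fin n) (Fin m) ℝ} (ha : (aᵀ * a).det ≠ 0) :
    gramPairing a a a = m := by
  rw [gramPairing, Matrix.mul_assoc, Matrix.trace_mul_comm, Matrix.mul_assoc,
    Matrix.nonsing_inv_mul _ (isUnit_iff_ne_zero.2 ha), Matrix.trace_one, Fintype.card_fin]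

theorem gramPairing_smul_sub (a u v : Matrix (Fin n) (Fin m) ℝ) (c : ℝ) :
    gramPairing a (u - c • v) (u - c • v) =
      gramPairing a u u - 2 * c * gramPairing a v u + c ^ 2 * gramPairing a v v := by
  have h := gramPairing_comm a u v
  simp only [gramPairing] at *
  simp only [mul_sub, Matrix.transpose_sub, Matrix.transpose_smul, Matrix.trace_sub,
    Matrix.trace_smul, smul_eq_mul, Matrix.smul_mul,
    Matrix.mul_smul, Matrix.sub_mul, Matrix.mul_sub, h]
  ring

/-- The Cauchy-Schwarz inequality against the base point. -/
theorem gramPairing_base_sq_le (hm : 0 < m) {a : Matrix (Fin n) (Fin m) ℝ}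
    (ha : (aᵀ * a).det ≠ 0) (v : Matrix (Fin n) (Fin m) ℝ) :
    gramPairing a a v ^ 2 ≤ m * gramPairing a v v := by
  have hm' : (0 : ℝ) < m := by exact_mod_cast hm
  -- The subtracted multiple of `a` is the orthogonal projection of `v` onto `a`, since `a` has
  -- squared norm `m`.
  have h := gramPairing_self_nonneg a (v - (gramPairing a a v / m) • a)
  rw [gramPairing_smul_sub, gramPairing_base_self ha] at h
  have e : gramPairing a v v - 2 * (gramPairing a a v / m) * gramPairing a a v +
    (gramPairing a a v / m) ^ 2 * m = gramPairing a v v - gramPairing a a v ^ 2 / m := by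
    field_simp; ring
  rw [e, sub_nonneg, div_le_iff₀ hm'] at h
  linarith

theorem gram_smul (f : ℝ) (a : Matrix (Fin n) (Fin m) ℝ) :
    (f • a)ᵀ * (f • a) = (f ^ 2) • (aᵀ * a) := by
  rw [Matrix.transpose_smul, Matrix.smul_mul, Matrix.mul_smul, smul_smul, sq]

theorem gramDensity_smul {f : ℝ} (hf : 0 < f) (a : Matrix (Fin n) (Fin m) ℝ) :
    gramDensity (f • a) = f ^ m * gramDensity a := by
  rw [gramDensity, gram_smul, Matrix.det_smul, Fintype.card_fin, ← pow_mul, mul_comm 2 m, pow_mul,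
    Real.sqrt_mul (by positivity), Real.sqrt_sq (by positivity), gramDensity]

theorem gram_inv_smul {f : ℝ} (hf : 0 < f) {a : Matrix (Fin n) (Fin m) ℝ}
    (ha : (aᵀ * a).det ≠ 0) :
    ((f • a)ᵀ * (f • a))⁻¹ = (f ^ 2)⁻¹ • (aᵀ * a)⁻¹ := by
  have := Matrix.inv_smul' (A := aᵀ * a) (Units.mk0 (f ^ 2) (by positivity))
    (isUnit_iff_ne_zero.2 ha)
  rw [gram_smul]
  exact this

theorem gramPairing_smul {f : ℝ} (hf : 0 < f) {a : Matrix (Fin n) (Fin m) ℝ}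
    (ha : (aᵀ * a).det ≠ 0) (g h : ℝ) (u v : Matrix (Fin n) (Fin m) ℝ) :
    gramPairing (f • a) (g • u) (h • v) = g * h / f ^ 2 * gramPairing a u v := by
  rw [gramPairing, gram_inv_smul hf ha]
  simp only [gramPairing, Matrix.transpose_smul, Matrix.smul_mul,
    Matrix.mul_smul, Matrix.trace_smul, smul_eq_mul]
  field_simp

/-- The density contributes `f ^ m` and the inverse Gram matrix `f ^ (-2)`. This homogeneity puts
the end of a ray at finite distance. -/
theorem matrixMetric_smul {f : ℝ} (hf : 0 < f) {a : Matrix (Fin n) (Fin m) ℝ}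
    (ha : (aᵀ * a).det ≠ 0) (g : ℝ) (u : Matrix (Fin n) (Fin m) ℝ) :
    matrixMetric (f • a) (g • u) (g • u) = f ^ m * (g / f) ^ 2 * matrixMetric a u u := by
  rw [matrixMetric_eq, gramPairing_smul hf ha, gramDensity_smul hf, matrixMetric_eq]
  ring

/-- The derivative of `matrixMetric a v v` in the direction `(h, k)`. -/
def metricVariation (a v h k : Matrix (Fin n) (Fin m) ℝ) : ℝ :=
  (2 * gramPairing a k v - 2 * (v * (aᵀ * a)⁻¹ * (hᵀ * a) * (aᵀ * a)⁻¹ * vᵀ).trace +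
    gramPairing a v v * gramPairing a a h) * gramDensity a

/-- This is the logarithmic derivative of the Gram determinant, the trace that Jacobi's formula
produces for the volume density. -/
theorem gram_inv_trace (a h : Matrix (Fin n) (Fin m) ℝ) :
    ((aᵀ * a)⁻¹ * (hᵀ * a + aᵀ * h)).trace = 2 * gramPairing a a h := by
  have h1 : ((aᵀ * a)⁻¹ * (hᵀ * a)).trace = gramPairing a a h := by
    rw [gramPairing, ← Matrix.mul_assoc, Matrix.trace_mul_comm, Matrix.mul_assoc]
  have h2 : ((aᵀ * a)⁻¹ * (aᵀ * h)).trace = gramPairing a a h := by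
    rw [gramPairing_comm, gramPairing, ← Matrix.mul_assoc, Matrix.trace_mul_comm, Matrix.mul_assoc]
  rw [mul_add, Matrix.trace_add, h1, h2]; ring

theorem hasDerivAt_gramDensity {A : ℝ → Matrix (Fin n) (Fin m) ℝ}
    {H : Matrix (Fin n) (Fin m) ℝ} {s : ℝ} (hA : HasDerivAt A H s)
    (h0 : 0 < ((A s)ᵀ * A s).det) :
    HasDerivAt (fun r => gramDensity (A r)) (gramPairing (A s) (A s) H * gramDensity (A s)) s := by
  have h1 := (hasDerivAt_matrix_det
    (hasDerivAt_matrix_mul (hasDerivAt_matrix_transpose hA) hA) h0.ne').sqrt h0.ne'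
  refine h1.congr_deriv ?_
  rw [gram_inv_trace, gramDensity]
  have := Real.sq_sqrt h0.le
  have hne := (Real.sqrt_pos.2 h0).ne'
  nth_rewrite 1 [← this]
  field_simp

theorem hasDerivAt_matrixMetric {A V : ℝ → Matrix (Fin n) (Fin m) ℝ}
    {H K : Matrix (Fin n) (Fin m) ℝ} {s : ℝ} (hA : HasDerivAt A H s) (hV : HasDerivAt V K s)
    (h0 : 0 < ((A s)ᵀ * A s).det) :
    HasDerivAt (fun r => matrixMetric (A r) (V r) (V r))
      (metricVariation (A s) (V s) H K) s := by
  have h1 := hasDerivAt_matrix_inv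
    (hasDerivAt_matrix_mul (hasDerivAt_matrix_transpose hA) hA) h0.ne'
  have h2 := (hasDerivAt_matrix_trace (hasDerivAt_matrix_mul (hasDerivAt_matrix_mul hV h1)
    (hasDerivAt_matrix_transpose hV))).mul (hasDerivAt_gramDensity hA h0)
  refine h2.congr_deriv ?_
  have e1 := gramPairing_comm (A s) (V s) K
  -- The two summands in the derivative of the Gram matrix are transposes of each other and
  -- contribute equally, whence the factor `2` in `metricVariation`.
  have e2 : (V s * ((A s)ᵀ * A s)⁻¹ * ((A s)ᵀ * H) * ((A s)ᵀ * A s)⁻¹ * (V s)ᵀ).trace =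
      (V s * ((A s)ᵀ * A s)⁻¹ * (Hᵀ * A s) * ((A s)ᵀ * A s)⁻¹ * (V s)ᵀ).trace := by
    rw [← Matrix.trace_transpose]
    simp only [Matrix.transpose_mul, gram_inv_transpose, Matrix.transpose_transpose, mul_assoc,
      Matrix.mul_assoc]
  simp only [gramPairing] at e1
  simp only [metricVariation, gramPairing, add_mul, mul_add, neg_mul, Matrix.trace_add,
    Matrix.trace_neg, ← mul_assoc, e1, Matrix.add_mul, Matrix.mul_add, ← Matrix.mul_assoc,
    Matrix.mul_neg, Matrix.neg_mul] at e2 ⊢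
  rw [e2]
  ring

/-- The first variation of the energy density along a ray. -/
theorem metricVariation_smul {f : ℝ} (hf : 0 < f) {a : Matrix (Fin n) (Fin m) ℝ}
    (ha : (aᵀ * a).det ≠ 0) (g : ℝ) (h k : Matrix (Fin n) (Fin m) ℝ) :
    metricVariation (f • a) (g • a) h k =
      (2 * (g / f ^ 2) * gramPairing a a k + (m - 2) * (g ^ 2 / f ^ 3) * gramPairing a a h) *
        (f ^ m * gramDensity a) := by
  have e1 : gramPairing (f • a) k (g • a) = g / f ^ 2 * gramPairing a a k := by
    rw [gramPairing_comm a a k]; simpa using gramPairing_smul hf ha 1 g k a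
  have e2 : gramPairing (f • a) (f • a) h = f / f ^ 2 * gramPairing a a h := by
    simpa using gramPairing_smul hf ha f 1 a h
  have e3 : ((g • a) * ((f • a)ᵀ * (f • a))⁻¹ * (hᵀ * (f • a)) * ((f • a)ᵀ * (f • a))⁻¹ *
      (g • a)ᵀ).trace = g ^ 2 / f ^ 3 * gramPairing a a h := by
    have e4 : (a * (aᵀ * a)⁻¹ * (hᵀ * a) * (aᵀ * a)⁻¹ * aᵀ).trace = gramPairing a a h := by
      rw [gramPairing, Matrix.trace_mul_comm]
      have : aᵀ * (a * (aᵀ * a)⁻¹ * (hᵀ * a) * (aᵀ * a)⁻¹) = hᵀ * (a * (aᵀ * a)⁻¹) := by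
        simp only [← Matrix.mul_assoc]
        rw [Matrix.mul_nonsing_inv _ (isUnit_iff_ne_zero.2 ha), Matrix.one_mul]
      rw [this, Matrix.trace_mul_comm]
    rw [gram_inv_smul hf ha, Matrix.transpose_smul]
    simp only [Matrix.smul_mul, Matrix.mul_smul, Matrix.trace_smul, smul_eq_mul, e4]
    field_simp
  rw [metricVariation, e1, e2, e3, gramPairing_smul hf ha, gramPairing_base_self ha,
    gramDensity_smul hf]
  field_simp
  ring

section Continuity

variable {X : Type*} [TopologicalSpace X] {S : Set X} {a u v h k : X → Matrix (Fin n) (Fin m) ℝ}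

theorem continuousOn_matrix_mul {p q r : ℕ} {a : X → Matrix (Fin p) (Fin q) ℝ}
    {b : X → Matrix (Fin q) (Fin r) ℝ} (ha : ContinuousOn a S) (hb : ContinuousOn b S) :
    ContinuousOn (fun x => a x * b x) S :=
  (continuous_fst.matrix_mul continuous_snd).comp_continuousOn (ha.prodMk hb)

theorem continuousOn_matrix_transpose {p q : ℕ} {a : X → Matrix (Fin p) (Fin q) ℝ}
    (ha : ContinuousOn a S) : ContinuousOn (fun x => (a x)ᵀ) S :=
  continuous_id.matrix_transpose.comp_continuousOn ha

theorem continuousOn_matrix_trace {p : ℕ} {a : X → Matrix (Fin p) (Fin p) ℝ}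
    (ha : ContinuousOn a S) : ContinuousOn (fun x => (a x).trace) S :=
  continuous_id.matrix_trace.comp_continuousOn ha

theorem continuousOn_gram_inv (ha : ContinuousOn a S) (h0 : ∀ x ∈ S, ((a x)ᵀ * a x).det ≠ 0) :
    ContinuousOn (fun x => ((a x)ᵀ * a x)⁻¹) S :=
  continuousOn_matrix_inv (continuousOn_matrix_mul (continuousOn_matrix_transpose ha) ha) h0

theorem continuousOn_gramDensity (ha : ContinuousOn a S) :
    ContinuousOn (fun x => gramDensity (a x)) S :=
  Real.continuous_sqrt.comp_continuousOn <| (continuous_id.matrix_det).comp_continuousOn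
    (continuousOn_matrix_mul (continuousOn_matrix_transpose ha) ha)

theorem continuousOn_gramPairing (ha : ContinuousOn a S)
    (h0 : ∀ x ∈ S, ((a x)ᵀ * a x).det ≠ 0) (hu : ContinuousOn u S) (hv : ContinuousOn v S) :
    ContinuousOn (fun x => gramPairing (a x) (u x) (v x)) S :=
  continuousOn_matrix_trace (continuousOn_matrix_mul (continuousOn_matrix_mul hu
    (continuousOn_gram_inv ha h0)) (continuousOn_matrix_transpose hv))

theorem continuousOn_matrixMetric (ha : ContinuousOn a S)
    (h0 : ∀ x ∈ S, ((a x)ᵀ * a x).det ≠ 0) (hu : ContinuousOn u S) (hv : ContinuousOn v S) :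
    ContinuousOn (fun x => matrixMetric (a x) (u x) (v x)) S :=
  (continuousOn_gramPairing ha h0 hu hv).mul (continuousOn_gramDensity ha)

theorem continuousOn_metricVariation (ha : ContinuousOn a S)
    (h0 : ∀ x ∈ S, ((a x)ᵀ * a x).det ≠ 0) (hv : ContinuousOn v S) (hh : ContinuousOn h S)
    (hk : ContinuousOn k S) :
    ContinuousOn (fun x => metricVariation (a x) (v x) (h x) (k x)) S := by
  have hi := continuousOn_gram_inv ha h0
  refine ContinuousOn.mul (ContinuousOn.add (ContinuousOn.sub ?_ ?_) ?_)
    (continuousOn_gramDensity ha)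
  · exact (continuousOn_gramPairing ha h0 hk hv).const_smul (2 : ℝ)
  · exact ContinuousOn.const_smul (continuousOn_matrix_trace (continuousOn_matrix_mul
      (continuousOn_matrix_mul (continuousOn_matrix_mul (continuousOn_matrix_mul hv hi)
        (continuousOn_matrix_mul (continuousOn_matrix_transpose hh) ha)) hi)
      (continuousOn_matrix_transpose hv))) (2 : ℝ)
  · exact (continuousOn_gramPairing ha h0 hv hv).mul (continuousOn_gramPairing ha h0 ha hh)

end Continuity

end LagrangianCalculus

/-! ### Integrals over a compact set depending on a parameter -/

section ParametricIntegral

variable {P : Type*} [TopologicalSpace P] [T2Space P] [MeasurableSpace P]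
  [OpensMeasurableSpace P] {μ : Measure P} [IsFiniteMeasureOnCompacts μ]
  {K : Set P} {Φ Φ' : ℝ → P → ℝ} {a b : ℝ}

theorem continuousOn_setIntegral_of_isCompact (hK : IsCompact K)
    (hΦ : ContinuousOn (Function.uncurry Φ) (Icc a b ×ˢ K)) :
    ContinuousOn (fun t => ∫ y in K, Φ t y ∂μ) (Icc a b) := by
  obtain ⟨C, hC⟩ := (isCompact_Icc.prod hK).exists_bound_of_continuousOn hΦ
  refine continuousOn_of_dominated (bound := fun _ => C) (fun t ht => ?_) (fun t ht => ?_)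
    (integrableOn_const hK.measure_lt_top.ne) ?_
  · exact (hΦ.comp (Continuous.prodMk_right t).continuousOn
      fun y hy => ⟨ht, hy⟩).aestronglyMeasurable hK.measurableSet
  · exact (ae_restrict_mem hK.measurableSet).mono fun y hy => hC (t, y) ⟨ht, hy⟩
  · exact (ae_restrict_mem hK.measurableSet).mono fun y hy =>
      hΦ.comp (Continuous.prodMk_left y).continuousOn fun t ht => ⟨ht, hy⟩

/-- Compactness of `Icc a b ×ˢ K` bounds the derivative by a constant, which is integrable on `K`
and serves as the dominating function. -/
theorem hasDerivAt_setIntegral_of_isCompact (hK : IsCompact K)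
    (hΦ : ContinuousOn (Function.uncurry Φ) (Icc a b ×ˢ K))
    (hΦ' : ContinuousOn (Function.uncurry Φ') (Icc a b ×ˢ K))
    (hd : ∀ t ∈ Ioo a b, ∀ y ∈ K, HasDerivAt (fun τ => Φ τ y) (Φ' t y) t) {t : ℝ}
    (ht : t ∈ Ioo a b) :
    HasDerivAt (fun τ => ∫ y in K, Φ τ y ∂μ) (∫ y in K, Φ' t y ∂μ) t := by
  obtain ⟨C, hC⟩ := (isCompact_Icc.prod hK).exists_bound_of_continuousOn hΦ'
  have hslice : ∀ {Ψ : ℝ → P → ℝ}, ContinuousOn (Function.uncurry Ψ) (Icc a b ×ˢ K) →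
      ∀ τ ∈ Ioo a b, ContinuousOn (Ψ τ) K := fun hΨ τ hτ =>
    hΨ.comp (Continuous.prodMk_right τ).continuousOn fun y hy => ⟨Ioo_subset_Icc_self hτ, hy⟩
  refine (hasDerivAt_integral_of_dominated_loc_of_deriv_le (bound := fun _ => C)
    (Ioo_mem_nhds ht.1 ht.2) ?_ ?_ ?_ ?_ (integrableOn_const hK.measure_lt_top.ne) ?_).2
  · filter_upwards [Ioo_mem_nhds ht.1 ht.2] with τ hτ
    exact (hslice hΦ τ hτ).aestronglyMeasurable hK.measurableSet
  · exact (hslice hΦ t ht).integrableOn_compact hK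
  · exact (hslice hΦ' t ht).aestronglyMeasurable hK.measurableSet
  · exact (ae_restrict_mem hK.measurableSet).mono fun y hy τ hτ =>
      hC (τ, y) ⟨Ioo_subset_Icc_self hτ, hy⟩
  · exact (ae_restrict_mem hK.measurableSet).mono fun y hy τ hτ => hd τ hτ y hy

end ParametricIntegral

/-! ### Coordinate matrices of full-ranked forms and of velocities -/

section ChartBasics

variable {m : ℕ} {H : Type*} [TopologicalSpace H]
  {I : ModelWithCorners ℝ (EuclideanSpace ℝ (Fin m)) H}
  {M : Type*} [TopologicalSpace M] [ChartedSpace H M] {n : ℕ}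

theorem extChartAt_symm_mem_source (i : M) {y : EuclideanSpace ℝ (Fin m)}
    (hy : y ∈ (extChartAt I i).target) : (extChartAt I i).symm y ∈ (chartAt H i).source := by
  rw [← extChartAt_source I]; exact (extChartAt I i).map_target hy

end ChartBasics

section Charts

attribute [local instance] Matrix.normedAddCommGroup Matrix.normedSpace

variable {m : ℕ} {H : Type*} [TopologicalSpace H]
  {I : ModelWithCorners ℝ (EuclideanSpace ℝ (Fin m)) H}
  {M : Type*} [TopologicalSpace M] [ChartedSpace H M] [IsManifold I ∞ M] {n : ℕ}

/-- Over the chart the coordinate matrix represents `α x` composed with a linear isomorphism, so it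
is injective and its Gram matrix is positive definite. -/
theorem det_gram_coordMatrix_pos {α : OneForm I M n} (hα : α ∈ fullRank I M n) (i : M)
    {y : EuclideanSpace ℝ (Fin m)} (hy : y ∈ (extChartAt I i).target) :
    0 < ((coordMatrix I i y fun x => α x)ᵀ * coordMatrix I i y fun x => α x).det := by
  have hx := extChartAt_symm_mem_source i hy
  refine Matrix.PosDef.det_pos (A := (coordMatrix I i y fun x => α x)ᴴ * coordMatrix I i y fun x => α x)
    (Matrix.PosDef.conjTranspose_mul_self _ ?_)
  rw [coordMatrix_eq_columns i hy]
  set x := (extChartAt I i).symm y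
  have hinj : Function.Injective (localForm I i x (α x)) := by
    refine (hα x).comp (Function.LeftInverse.injective (g :=
      (trivializationAt (EuclideanSpace ℝ (Fin m)) (TangentSpace I) i).continuousLinearMapAt ℝ x)
      fun v => ?_)
    exact Trivialization.continuousLinearMapAt_symmL _ (by simpa using hx) v
  have hmul : ∀ v : Fin m → ℝ, (columns (localForm I i x (α x))).mulVec v =
      (localForm I i x (α x) (WithLp.toLp 2 v)).ofLp := by
    intro v
    have hv : WithLp.toLp 2 v = ∑ j, v j • EuclideanSpace.single j (1 : ℝ) := by
      ext j
      simp [Pi.single_apply]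
    ext k
    rw [hv, map_sum]
    simp only [Matrix.mulVec, dotProduct, map_smul, WithLp.ofLp_sum, WithLp.ofLp_smul,
      Finset.sum_apply, Pi.smul_apply, smul_eq_mul]
    exact Finset.sum_congr rfl fun j _ => mul_comm _ _
  intro v w hvw
  rw [hmul, hmul] at hvw
  exact WithLp.toLp_injective 2 (hinj (WithLp.ofLp_injective 2 hvw))

/-- The velocity is a derivative inside one fibre, and a fixed linear isomorphism carries that fibre
to the model space, so differentiation commutes with passing to coordinates. -/
theorem coordMatrix_velocity {γ : ℝ → OneForm I M n} {t : ℝ} (i : M)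
    {y : EuclideanSpace ℝ (Fin m)} (hy : y ∈ (extChartAt I i).target)
    {F : EuclideanSpace ℝ (Fin m) →L[ℝ] EuclideanSpace ℝ (Fin n)}
    (hF : HasDerivAt (fun τ => localForm I i ((extChartAt I i).symm y)
      (γ τ ((extChartAt I i).symm y))) F t) :
    coordMatrix I i y (velocity γ t) = columns F := by
  have hx := extChartAt_symm_mem_source i hy
  rw [coordMatrix_eq_columns i hy]
  set x := (extChartAt I i).symm y
  have h1 : HasDerivAt (fun τ => (γ τ x : FormFibre I M n x)) (ofLocalForm I i x F) t := by
    have h2 : HasDerivAt (fun τ => ofLocalForm I i x (localForm I i x (γ τ x)))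
        (ofLocalForm I i x F) t := by
      exact ((ContinuousLinearMap.compL ℝ (EuclideanSpace ℝ (Fin m)) (EuclideanSpace ℝ (Fin m))
        (EuclideanSpace ℝ (Fin n))).flip
        ((trivializationAt (EuclideanSpace ℝ (Fin m)) (TangentSpace I) i).continuousLinearMapAt
          ℝ x)).hasFDerivAt.comp_hasDerivAt t hF
    simpa only [ofLocalForm_localForm hx] using h2
  have h3 : velocity γ t x = ofLocalForm I i x F :=
    HasDerivAt.deriv (F := EuclideanSpace ℝ (Fin m) →L[ℝ] EuclideanSpace ℝ (Fin n)) h1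
  rw [h3, localForm_ofLocalForm hx]

theorem hasDerivAt_columns {F : ℝ → EuclideanSpace ℝ (Fin m) →L[ℝ] EuclideanSpace ℝ (Fin n)}
    {F' : EuclideanSpace ℝ (Fin m) →L[ℝ] EuclideanSpace ℝ (Fin n)} {t : ℝ}
    (h : HasDerivAt F F' t) : HasDerivAt (fun τ => columns (F τ)) (columns F') t :=
  (LinearMap.toContinuousLinearMap columns).hasFDerivAt.comp_hasDerivAt t h

theorem continuous_columns : Continuous (columns (m := m) (n := n)) :=
  LinearMap.continuous_of_finiteDimensional _

/-- The time derivative of the coordinate expression of a smooth curve. -/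
theorem SmoothCurveOn.exists_localVelocity {γ : ℝ → OneForm I M n} {a b : ℝ} (hab : a < b)
    (hγ : SmoothCurveOn I γ (Icc a b)) (i : M) :
    ∃ V : ℝ × EuclideanSpace ℝ (Fin m) →
        (EuclideanSpace ℝ (Fin m) →L[ℝ] EuclideanSpace ℝ (Fin n)),
      ContinuousOn V (Icc a b ×ˢ (extChartAt I i).target) ∧
      ∀ t ∈ Ioo a b, ∀ y ∈ (extChartAt I i).target,
        HasDerivAt (fun τ => localForm I i ((extChartAt I i).symm y)
          (γ τ ((extChartAt I i).symm y))) (V (t, y)) t := by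
  have hF := hγ.contDiffOn_localForm i
  have hu : UniqueDiffOn ℝ (Icc a b ×ˢ (extChartAt I i).target) :=
    (uniqueDiffOn_Icc hab).prod (uniqueDiffOn_extChartAt_target i)
  refine ⟨fun p => fderivWithin ℝ _ (Icc a b ×ˢ (extChartAt I i).target) p (1, 0),
    (hF.continuousOn_fderivWithin hu (by simp)).clm_apply continuousOn_const, ?_⟩
  intro t ht y hy
  have h1 := (hF.differentiableOn (by simp) (t, y)
    ⟨Ioo_subset_Icc_self ht, hy⟩).hasFDerivWithinAt
  have h2 : HasDerivWithinAt (fun τ : ℝ => (τ, y)) ((1 : ℝ), (0 : EuclideanSpace ℝ (Fin m)))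
      (Icc a b) t := (hasDerivWithinAt_id t _).prodMk (hasDerivWithinAt_const _ _ _)
  have h3 : MapsTo (fun τ : ℝ => (τ, y)) (Icc a b) (Icc a b ×ˢ (extChartAt I i).target) :=
    fun τ hτ => ⟨hτ, hy⟩
  exact (h1.comp_hasDerivWithinAt t h2 h3).hasDerivAt
    (Icc_mem_nhds ht.1 ht.2)

theorem SmoothCurveOn.continuousOn_coordMatrix {γ : ℝ → OneForm I M n} {J : Set ℝ}
    (hγ : SmoothCurveOn I γ J) (i : M) :
    ContinuousOn (fun p : ℝ × EuclideanSpace ℝ (Fin m) =>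
      coordMatrix I i p.2 fun x => γ p.1 x) (J ×ˢ (extChartAt I i).target) :=
  (continuous_columns.comp_continuousOn (hγ.contDiffOn_localForm i).continuousOn).congr
    fun _ hp => coordMatrix_eq_columns i hp.2 _

end Charts

/-! ### The metric as a finite sum of integrals over compact sets -/

section Partition

variable {m : ℕ} {H : Type*} [TopologicalSpace H]
  (I : ModelWithCorners ℝ (EuclideanSpace ℝ (Fin m)) H)
  {M : Type*} [TopologicalSpace M] [ChartedSpace H M] [IsManifold I ∞ M] {n : ℕ}
  [T2Space M] [CompactSpace M]

/-- The image in the chart at `i` of the support of the `i`-th function of the partition. -/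
def chartSupport (i : M) : Set (EuclideanSpace ℝ (Fin m)) :=
  extChartAt I i '' tsupport (chartPartition I M i)

/-- The `i`-th function of the partition of unity in the chart at `i`. -/
def chartWeight (i : M) (y : EuclideanSpace ℝ (Fin m)) : ℝ :=
  chartPartition I M i ((extChartAt I i).symm y)

theorem tsupport_chartPartition_subset (i : M) :
    tsupport (chartPartition I M i) ⊆ (extChartAt I i).source := by
  rw [extChartAt_source]; exact chartPartition_isSubordinate I M i

theorem chartSupport_subset (i : M) : chartSupport I i ⊆ (extChartAt I i).target := by
  rintro _ ⟨x, hx, rfl⟩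
  exact (extChartAt I i).map_source (tsupport_chartPartition_subset I i hx)

theorem isCompact_chartSupport (i : M) : IsCompact (chartSupport I i) :=
  (isClosed_tsupport _).isCompact.image_of_continuousOn
    ((continuousOn_extChartAt i).mono (tsupport_chartPartition_subset I i))

theorem chartWeight_nonneg (i : M) (y : EuclideanSpace ℝ (Fin m)) : 0 ≤ chartWeight I i y :=
  (chartPartition I M).nonneg i _

theorem chartWeight_eq_zero (i : M) {y : EuclideanSpace ℝ (Fin m)}
    (hy : y ∈ (extChartAt I i).target) (hy' : y ∉ chartSupport I i) : chartWeight I i y = 0 := by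
  by_contra h
  exact hy' ⟨(extChartAt I i).symm y, subset_tsupport _ h, (extChartAt I i).right_inv hy⟩

theorem continuousOn_chartWeight (i : M) :
    ContinuousOn (chartWeight I i) (extChartAt I i).target :=
  (chartPartition I M i).contMDiff.continuous.comp_continuousOn (continuousOn_extChartAt_symm i)

theorem finite_chartPartition_ne_zero :
    {i : M | (Function.support (chartPartition I M i)).Nonempty}.Finite :=
  (chartPartition I M).locallyFinite.finite_nonempty_of_compact

/-- The indices of the partition functions that do not vanish identically. -/
def chartIndices : Finset M := (finite_chartPartition_ne_zero I (M := M)).toFinset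

/-- The chart target need not be compact; restricting to the support of the weight makes continuity
sufficient for integrability and domination. -/
theorem setIntegral_target_eq (i : M) (f : EuclideanSpace ℝ (Fin m) → ℝ) :
    ∫ y in (extChartAt I i).target, chartWeight I i y * f y =
      ∫ y in chartSupport I i, chartWeight I i y * f y := by
  refine setIntegral_eq_of_subset_of_forall_sdiff_eq_zero ?_ (chartSupport_subset I i) ?_
  · rw [extChartAt_target]
    exact ((chartAt H i).open_target.preimage I.continuous_symm).measurableSet.inter
      I.isClosed_range.measurableSet
  · intro y hy
    rw [chartWeight_eq_zero I i hy.1 hy.2, zero_mul]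

/-- Local finiteness on a compact manifold leaves finitely many nonzero partition functions, an
index set that does not depend on the forms. -/
theorem ebinMetric_eq_sum (α ζ η : ∀ x, FormFibre I M n x) :
    ebinMetric I α ζ η = ∑ i ∈ chartIndices I, ∫ y in chartSupport I i, chartWeight I i y *
      matrixMetric (coordMatrix I i y α) (coordMatrix I i y ζ) (coordMatrix I i y η) := by
  rw [ebinMetric, finsum_eq_sum_of_support_subset (s := chartIndices I)]
  · exact Finset.sum_congr rfl fun i _ => setIntegral_target_eq I i _
  · intro i hi
    simp only [chartIndices, Finite.coe_toFinset, mem_ofPred_eq]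
    by_contra h
    apply hi
    have h0 : ∀ x, chartPartition I M i x = 0 := fun x => by
      by_contra hx
      exact h ⟨x, hx⟩
    simp [h0]

end Partition

/-! ### First variation of the energy -/

section FirstVariation

attribute [local instance] Matrix.normedAddCommGroup Matrix.normedSpace

variable {m : ℕ} {H : Type*} [TopologicalSpace H]
  {I : ModelWithCorners ℝ (EuclideanSpace ℝ (Fin m)) H}
  {M : Type*} [TopologicalSpace M] [ChartedSpace H M] [IsManifold I ∞ M] {n : ℕ}
  [T2Space M] [CompactSpace M]

/-- A tube-lemma argument; applied to Gram determinants, it keeps the varied curve full-ranked on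
the whole compact set for small parameters. -/
theorem eventually_forall_pos_of_isCompact {P : Type*} [TopologicalSpace P] {C : Set P}
    (hC : IsCompact C) {g : ℝ → P → ℝ} (hg : ContinuousOn (Function.uncurry g) (univ ×ˢ C))
    (h0 : ∀ p ∈ C, 0 < g 0 p) : ∀ᶠ s in 𝓝 (0 : ℝ), ∀ p ∈ C, 0 < g s p := by
  have := isCompact_iff_compactSpace.1 hC
  have hcont : Continuous (fun z : ℝ × C => g z.1 z.2) :=
    hg.comp_continuous (f := fun z : ℝ × C => (z.1, (z.2 : P))) (by fun_prop)
      fun z => ⟨mem_univ _, z.2.2⟩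
  have h := (isCompact_univ (X := C)).eventually_forall_of_forall_eventually (x₀ := (0 : ℝ))
    (P := fun s p => 0 < g s p)
    fun p _ => hcont.continuousAt.eventually (lt_mem_nhds (h0 p p.2))
  filter_upwards [h] with s hs p hp using hs ⟨p, hp⟩ (mem_univ _)

/-- The derivative of the integral of a weighted energy density along an affine variation. -/
theorem hasDerivAt_integral_matrixMetric {P : Type*} [TopologicalSpace P] [T2Space P]
    [MeasurableSpace P] [OpensMeasurableSpace P] {μ : Measure P} [IsFiniteMeasureOnCompacts μ]
    {C : Set P} (hC : IsCompact C) {w : P → ℝ} {A V B W : P → Matrix (Fin n) (Fin m) ℝ}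
    (hw : ContinuousOn w C) (hA : ContinuousOn A C) (hV : ContinuousOn V C)
    (hB : ContinuousOn B C) (hW : ContinuousOn W C) (h0 : ∀ p ∈ C, 0 < ((A p)ᵀ * A p).det) :
    HasDerivAt (fun s : ℝ => ∫ p in C, w p *
        matrixMetric (A p + s • B p) (V p + s • W p) (V p + s • W p) ∂μ)
      (∫ p in C, w p * metricVariation (A p) (V p) (B p) (W p) ∂μ) 0 ∧
    ∀ᶠ s : ℝ in 𝓝 0, ContinuousOn (fun p => w p *
        matrixMetric (A p + s • B p) (V p + s • W p) (V p + s • W p)) C := by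
  have hsnd : ∀ {S : Set ℝ} {Z : P → Matrix (Fin n) (Fin m) ℝ}, ContinuousOn Z C →
      ContinuousOn (fun z : ℝ × P => Z z.2) (S ×ˢ C) := fun hZ =>
    hZ.comp continuousOn_snd fun z hz => hz.2
  have haff : ∀ {S : Set ℝ} {Y Z : P → Matrix (Fin n) (Fin m) ℝ}, ContinuousOn Y C →
      ContinuousOn Z C → ContinuousOn (fun z : ℝ × P => Y z.2 + z.1 • Z z.2) (S ×ˢ C) :=
    fun hY hZ => (hsnd hY).add (continuousOn_fst.smul (hsnd hZ))
  have hev := eventually_forall_pos_of_isCompact hC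
    (g := fun s p => ((A p + s • B p)ᵀ * (A p + s • B p)).det)
    ((continuous_id.matrix_det).comp_continuousOn (continuousOn_matrix_mul
      (continuousOn_matrix_transpose (haff hA hB)) (haff hA hB))) (by simpa using h0)
  obtain ⟨ε, hε, hball⟩ := Metric.eventually_nhds_iff_ball.1 hev
  have hsub : ∀ s ∈ Icc (-(ε / 2)) (ε / 2), s ∈ Metric.ball (0 : ℝ) ε := fun s hs => by
    rw [mem_ball_zero_iff, Real.norm_eq_abs]
    exact (abs_le.2 hs).trans_lt (half_lt_self hε)
  have hw' : ContinuousOn (fun z : ℝ × P => w z.2) (Icc (-(ε / 2)) (ε / 2) ×ˢ C) :=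
    hw.comp continuousOn_snd fun z hz => hz.2
  have hne : ∀ z ∈ Icc (-(ε / 2)) (ε / 2) ×ˢ C,
      ((A z.2 + z.1 • B z.2)ᵀ * (A z.2 + z.1 • B z.2)).det ≠ 0 :=
    fun z hz => (hball z.1 (hsub _ hz.1) z.2 hz.2).ne'
  have hΦ := hw'.mul (continuousOn_matrixMetric (haff hA hB) hne (haff hV hW) (haff hV hW))
  have hline : ∀ (Y Z : Matrix (Fin n) (Fin m) ℝ) (s : ℝ),
      HasDerivAt (fun r : ℝ => Y + r • Z) Z s := fun Y Z s => by
    rw [hasDerivAt_matrix_iff]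
    intro i j
    simpa using ((hasDerivAt_id s).mul_const (Z i j)).const_add (Y i j)
  constructor
  · have h := hasDerivAt_setIntegral_of_isCompact (μ := μ) hC
      (Φ := fun s p => w p * matrixMetric (A p + s • B p) (V p + s • W p) (V p + s • W p))
      (Φ' := fun s p => w p * metricVariation (A p + s • B p) (V p + s • W p) (B p) (W p))
      hΦ (hw'.mul (continuousOn_metricVariation (haff hA hB) hne (haff hV hW)
        (hsnd hB) (hsnd hW)))
      (fun s hs p hp => (hasDerivAt_matrixMetric (hline _ _ s) (hline _ _ s)
        (hball s (hsub s (Ioo_subset_Icc_self hs)) p hp)).const_mul (w p))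
      (t := 0) ⟨by linarith, by linarith⟩
    simpa using h
  · filter_upwards [Icc_mem_nhds (show -(ε / 2) < 0 by linarith) (show 0 < ε / 2 by linarith)]
      with s hs
    exact hΦ.comp (Continuous.prodMk_right s).continuousOn fun p hp => ⟨hs, hp⟩

theorem ebinMetric_variation {γ h : ℝ → OneForm I M n} {t : ℝ}
    {V W : M → EuclideanSpace ℝ (Fin m) →
      (EuclideanSpace ℝ (Fin m) →L[ℝ] EuclideanSpace ℝ (Fin n))}
    (hV : ∀ i, ∀ y ∈ (extChartAt I i).target, HasDerivAt (fun τ =>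
      localForm I i ((extChartAt I i).symm y) (γ τ ((extChartAt I i).symm y))) (V i y) t)
    (hW : ∀ i, ∀ y ∈ (extChartAt I i).target, HasDerivAt (fun τ =>
      localForm I i ((extChartAt I i).symm y) (h τ ((extChartAt I i).symm y))) (W i y) t)
    (s : ℝ) :
    ebinMetric I (fun x => (γ t + s • h t) x) (velocity (fun τ => γ τ + s • h τ) t)
        (velocity (fun τ => γ τ + s • h τ) t) =
      ∑ i ∈ chartIndices I, ∫ y in chartSupport I i, chartWeight I i y *
        matrixMetric ((coordMatrix I i y fun x => γ t x) + s • coordMatrix I i y fun x => h t x)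
          (columns (V i y) + s • columns (W i y)) (columns (V i y) + s • columns (W i y)) := by
  rw [ebinMetric_eq_sum]
  refine Finset.sum_congr rfl fun i _ =>
    setIntegral_congr_fun (isCompact_chartSupport I i).measurableSet fun y hy => ?_
  have hy' := chartSupport_subset I i hy
  have hd : HasDerivAt (fun τ => localForm I i ((extChartAt I i).symm y)
      ((γ τ + s • h τ) ((extChartAt I i).symm y))) (V i y + s • W i y) t :=
    (hV i y hy').add ((hW i y hy').const_smul s)
  have e := coordMatrix_velocity (γ := fun τ => γ τ + s • h τ) i hy' hd
  rw [map_add, map_smul] at e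
  simp only [e]
  rfl

/-- The first variation of the energy. -/
theorem hasDerivAt_energy {γ h : ℝ → OneForm I M n} {a b : ℝ} (hab : a < b)
    (hγ : SmoothCurveOn I γ (Icc a b)) (hfull : ∀ t ∈ Icc a b, γ t ∈ fullRank I M n)
    (hh : SmoothCurveOn I h (Icc a b))
    {V W : M → ℝ × EuclideanSpace ℝ (Fin m) →
      (EuclideanSpace ℝ (Fin m) →L[ℝ] EuclideanSpace ℝ (Fin n))}
    (hVc : ∀ i, ContinuousOn (V i) (Icc a b ×ˢ (extChartAt I i).target))
    (hV : ∀ i, ∀ t ∈ Ioo a b, ∀ y ∈ (extChartAt I i).target, HasDerivAt (fun τ =>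
      localForm I i ((extChartAt I i).symm y) (γ τ ((extChartAt I i).symm y))) (V i (t, y)) t)
    (hWc : ∀ i, ContinuousOn (W i) (Icc a b ×ˢ (extChartAt I i).target))
    (hW : ∀ i, ∀ t ∈ Ioo a b, ∀ y ∈ (extChartAt I i).target, HasDerivAt (fun τ =>
      localForm I i ((extChartAt I i).symm y) (h τ ((extChartAt I i).symm y))) (W i (t, y)) t) :
    HasDerivAt (fun s : ℝ => energy (fun t => γ t + s • h t) a b)
      (∑ i ∈ chartIndices I, ∫ p in Icc a b ×ˢ chartSupport I i, chartWeight I i p.2 *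
        metricVariation (coordMatrix I i p.2 fun x => γ p.1 x) (columns (V i p))
          (coordMatrix I i p.2 fun x => h p.1 x) (columns (W i p))
        ∂((volume : Measure ℝ).prod (volume : Measure (EuclideanSpace ℝ (Fin m))))) 0 := by
  have hsub : ∀ i : M, Icc a b ×ˢ chartSupport I i ⊆ Icc a b ×ˢ (extChartAt I i).target :=
    fun i => prod_mono_right (chartSupport_subset I i)
  have hC : ∀ i : M, IsCompact (Icc a b ×ˢ chartSupport I i) := fun i =>
    isCompact_Icc.prod (isCompact_chartSupport I i)
  have key := fun i : M => hasDerivAt_integral_matrixMetric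
    (μ := (volume : Measure ℝ).prod (volume : Measure (EuclideanSpace ℝ (Fin m)))) (hC i)
    (w := fun p => chartWeight I i p.2)
    (((continuousOn_chartWeight I i).mono (chartSupport_subset I i)).comp continuousOn_snd
      fun p hp => hp.2)
    ((hγ.continuousOn_coordMatrix i).mono (hsub i))
    (continuous_columns.comp_continuousOn ((hVc i).mono (hsub i)))
    ((hh.continuousOn_coordMatrix i).mono (hsub i))
    (continuous_columns.comp_continuousOn ((hWc i).mono (hsub i)))
    fun p hp => det_gram_coordMatrix_pos (hfull p.1 hp.1) i (hsub i hp).2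
  refine (HasDerivAt.fun_sum fun i _ => (key i).1).congr_of_eventuallyEq ?_
  have hev : ∀ᶠ s : ℝ in 𝓝 0, ∀ i ∈ chartIndices I (M := M), _ :=
    (Finset.eventually_all _).2 fun i _ => (key i).2
  filter_upwards [hev] with s hs
  -- The velocity is a two-sided derivative, uncontrolled at `a` and `b` for curves smooth only on
  -- `Icc a b`; the open interval avoids the endpoints at no cost.
  rw [energy, intervalIntegral.integral_of_le hab.le, integral_Ioc_eq_integral_Ioo]
  rw [setIntegral_congr_fun measurableSet_Ioo fun t ht =>
    ebinMetric_variation (fun i y hy => hV i t ht y hy) (fun i y hy => hW i t ht y hy) s,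
    ← integral_Icc_eq_integral_Ioo, integral_finsetSum]
  · refine Finset.sum_congr rfl fun i hi => ?_
    rw [setIntegral_prod _ ((hs i hi).integrableOn_compact (hC i))]
    rfl
  · intro i hi
    exact (continuousOn_setIntegral_of_isCompact
      (Φ := fun t y => chartWeight I i y * matrixMetric
        ((coordMatrix I i y fun x => γ t x) + s • coordMatrix I i y fun x => h t x)
        (columns (V i (t, y)) + s • columns (W i (t, y)))
        (columns (V i (t, y)) + s • columns (W i (t, y))))
      (isCompact_chartSupport I i) (hs i hi)).integrableOn_compact isCompact_Icc

end FirstVariation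

/-! ### Rays parametrized by a power of an affine function are geodesics -/

section PowerCurve

attribute [local instance] Matrix.normedAddCommGroup Matrix.normedSpace

/-- The power function `(r + q t)^(2/m)`. -/
def affinePow (m : ℕ) (r q t : ℝ) : ℝ := (r + q * t) ^ (2 / (m : ℝ))

theorem affinePow_pos {m : ℕ} {r q t : ℝ} (h : 0 < r + q * t) : 0 < affinePow m r q t :=
  Real.rpow_pos_of_pos h _

theorem affinePow_pow {m : ℕ} (hm : 0 < m) {r q t : ℝ} (h : 0 < r + q * t) :
    affinePow m r q t ^ m = (r + q * t) ^ 2 := by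
  rw [affinePow, ← Real.rpow_natCast, ← Real.rpow_mul h.le, div_mul_cancel₀ _ (by positivity),
    ← Real.rpow_natCast]
  norm_num

theorem hasDerivAt_affinePow {m : ℕ} {r q t : ℝ} (h : 0 < r + q * t) :
    HasDerivAt (affinePow m r q) (2 * q / m * (affinePow m r q t / (r + q * t))) t := by
  have h1 : HasDerivAt (fun τ => r + q * τ) q t := by
    simpa using ((hasDerivAt_id t).const_mul q).const_add r
  refine (h1.rpow_const (p := 2 / (m : ℝ)) (Or.inl h.ne')).congr_deriv ?_
  rw [Real.rpow_sub_one h.ne', affinePow]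
  ring

theorem contDiffOn_affinePow {m : ℕ} {r q : ℝ} {J : Set ℝ} (h : ∀ t ∈ J, 0 < r + q * t) :
    ContDiffOn ℝ ∞ (affinePow m r q) J := fun t ht =>
  ContDiffWithinAt.rpow_const_of_ne (by fun_prop) (h t ht).ne'

variable {m : ℕ} {H : Type*} [TopologicalSpace H]
  {I : ModelWithCorners ℝ (EuclideanSpace ℝ (Fin m)) H}
  {M : Type*} [TopologicalSpace M] [ChartedSpace H M] [IsManifold I ∞ M] {n : ℕ}

theorem smoothCurveOn_smul {φ : ℝ → ℝ} {J : Set ℝ} (hφ : ContDiffOn ℝ ∞ φ J)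
    (α : OneForm I M n) : SmoothCurveOn I (fun t => φ t • α) J := by
  rintro ⟨t, x⟩ hp
  have hα : ContMDiffWithinAt (𝓘(ℝ, ℝ).prod I)
      (I.prod 𝓘(ℝ, EuclideanSpace ℝ (Fin m) →L[ℝ] EuclideanSpace ℝ (Fin n))) ∞
      (fun p : ℝ × M =>
        (TotalSpace.mk' (EuclideanSpace ℝ (Fin m) →L[ℝ] EuclideanSpace ℝ (Fin n)) p.2 (α p.2) :
          TotalSpace (EuclideanSpace ℝ (Fin m) →L[ℝ] EuclideanSpace ℝ (Fin n))
            (FormFibre I M n))) (J ×ˢ univ) (t, x) :=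
    (α.contMDiff.comp contMDiff_snd).contMDiffAt.contMDiffWithinAt
  have hmem : ∀ B : FormFibre I M n x,
      (⟨x, B⟩ : TotalSpace (EuclideanSpace ℝ (Fin m) →L[ℝ] EuclideanSpace ℝ (Fin n))
        (FormFibre I M n)) ∈ (trivializationAt
        (EuclideanSpace ℝ (Fin m) →L[ℝ] EuclideanSpace ℝ (Fin n)) (FormFibre I M n) x).source :=
    fun B => by rw [Trivialization.mem_source]; simp
  rw [Trivialization.contMDiffWithinAt_iff
    (e := trivializationAt (EuclideanSpace ℝ (Fin m) →L[ℝ] EuclideanSpace ℝ (Fin n))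
      (FormFibre I M n) x)] at hα ⊢
  rotate_left
  · exact hmem _
  · exact hmem _
  refine ⟨hα.1, ?_⟩
  have hφ' : ContMDiffWithinAt (𝓘(ℝ, ℝ).prod I) 𝓘(ℝ, ℝ) ∞ (fun p : ℝ × M => φ p.1)
      (J ×ˢ univ) (t, x) :=
    (hφ.contMDiffOn t hp.1).comp (t, x) contMDiffWithinAt_fst fun p hp => hp.1
  refine (hφ'.smul hα.2).congr_of_eventuallyEq (Eventually.of_forall fun p => ?_) ?_
  · simp only [trivialization_apply_eq_localForm]
    exact map_smul (localForm I x p.2) (φ p.1) (α p.2)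
  · simp only [trivialization_apply_eq_localForm]
    exact map_smul (localForm I x x) (φ t) (α x)

theorem smul_mem_fullRank {α : OneForm I M n} (hα : α ∈ fullRank I M n) {f : ℝ} (hf : f ≠ 0) :
    f • α ∈ fullRank I M n := fun x _ _ hvw =>
  hα x (smul_right_injective _ hf hvw)

/-- The curve `t ↦ (r + q t)^(2/m) α`. -/
def powerCurve (α : OneForm I M n) (r q t : ℝ) : OneForm I M n := affinePow m r q t • α

theorem scalingCurve_eq_powerCurve (α : OneForm I M n) (c : ℝ) :
    scalingCurve α c = powerCurve α 1 (c * m / 2) := by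
  ext1 t
  rw [scalingCurve, powerCurve, affinePow]
  congr 3
  ring

theorem hasDerivAt_localForm_powerCurve (α : OneForm I M n) {r q t : ℝ} (h : 0 < r + q * t)
    (i x : M) :
    HasDerivAt (fun τ => localForm I i x (powerCurve α r q τ x))
      ((2 * q / m * (affinePow m r q t / (r + q * t))) • localForm I i x (α x)) t := by
  have := (hasDerivAt_affinePow (m := m) h).smul_const (localForm I i x (α x))
  exact this

variable [T2Space M] [CompactSpace M]

/-- The Euler-Lagrange equation at a single point of a chart, in integrated form. The power `2 / m`
makes the integrand an exact derivative. -/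
theorem integral_variation_powerCurve_eq_zero (hm : 0 < m) {r q a b : ℝ} (hab : a < b)
    (hpos : ∀ t ∈ Icc a b, 0 < r + q * t) {A : Matrix (Fin n) (Fin m) ℝ}
    (hA : (Aᵀ * A).det ≠ 0) {V B W : ℝ → Matrix (Fin n) (Fin m) ℝ}
    (hVc : ContinuousOn V (Icc a b))
    (hV : ∀ t ∈ Ioo a b, V t = (2 * q / m * (affinePow m r q t / (r + q * t))) • A)
    (hB : ContinuousOn B (Icc a b)) (hWc : ContinuousOn W (Icc a b))
    (hW : ∀ t ∈ Ioo a b, HasDerivAt B (W t) t) (hBa : B a = 0) (hBb : B b = 0) :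
    ∫ t in Icc a b, metricVariation (affinePow m r q t • A) (V t) (B t) (W t) = 0 := by
  have hm' : (m : ℝ) ≠ 0 := by positivity
  have hfc : ContinuousOn (affinePow m r q) (Icc a b) := (contDiffOn_affinePow hpos).continuousOn
  have hne : ∀ t ∈ Icc a b, ((affinePow m r q t • A)ᵀ * (affinePow m r q t • A)).det ≠ 0 := by
    intro t ht
    rw [gram_smul, Matrix.det_smul]
    exact mul_ne_zero (pow_ne_zero _ (pow_ne_zero _ (affinePow_pos (hpos t ht)).ne')) hA
  have hint := continuousOn_metricVariation (hfc.smul continuousOn_const) hne hVc hB hWc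
  rw [integral_Icc_eq_integral_Ioc, ← intervalIntegral.integral_of_le hab.le]
  have hpair : ∀ t ∈ Ioo a b, HasDerivAt (fun τ => gramPairing A A (B τ))
      (gramPairing A A (W t)) t := fun t ht => by
    have := hasDerivAt_matrix_trace (hasDerivAt_matrix_mul
      (hasDerivAt_const t (A * (Aᵀ * A)⁻¹)) (hasDerivAt_matrix_transpose (hW t ht)))
    refine this.congr_deriv ?_
    simp [gramPairing]
  -- The primitive is the momentum `2 ⟨A', B⟩` of the ray: with `f' = (2 q / m) f / ρ` and `f ^ m =
  -- ρ ^ 2`, its coefficient `2 f' f ^ (m - 2)` equals `2 (2 q / m) ρ / f`. It vanishes where `B`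
  -- does.
  rw [intervalIntegral.integral_eq_sub_of_hasDerivAt_of_le
    (f := fun t => 2 * (2 * q / m) * gramDensity A *
      ((r + q * t) / affinePow m r q t * gramPairing A A (B t))) hab.le]
  · simp [hBa, hBb, gramPairing]
  · refine continuousOn_const.mul (ContinuousOn.mul (ContinuousOn.div (by fun_prop) hfc
      fun t ht => (affinePow_pos (hpos t ht)).ne') ?_)
    exact continuousOn_matrix_trace (continuousOn_matrix_mul continuousOn_const
      (continuousOn_matrix_transpose hB))
  · intro t ht
    have hu := hpos t (Ioo_subset_Icc_self ht)
    have hf := affinePow_pos (m := m) hu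
    have h1 : HasDerivAt (fun τ => r + q * τ) q t := by
      simpa using ((hasDerivAt_id t).const_mul q).const_add r
    refine (((h1.div (hasDerivAt_affinePow hu) hf.ne').mul (hpair t ht)).const_mul _).congr_deriv ?_
    rw [hV t ht, metricVariation_smul hf hA, affinePow_pow hm hu]
    simp only [Pi.div_apply]
    field_simp
    ring
  · rw [intervalIntegrable_iff_integrableOn_Icc_of_le hab.le]
    exact hint.integrableOn_compact isCompact_Icc

theorem isGeodesicOn_powerCurve (hm : 0 < m) {α : OneForm I M n} (hα : α ∈ fullRank I M n)
    {r q : ℝ} {J : Set ℝ} (hpos : ∀ t ∈ J, 0 < r + q * t) :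
    IsGeodesicOn (powerCurve α r q) J where
  smooth := smoothCurveOn_smul (contDiffOn_affinePow hpos) α
  mem_fullRank t ht := smul_mem_fullRank hα (affinePow_pos (hpos t ht)).ne'
  critical a b hab hJ h hh ha hb := by
    have hpos' : ∀ t ∈ Icc a b, 0 < r + q * t := fun t ht => hpos t (hJ ht)
    have hγ : SmoothCurveOn I (powerCurve α r q) (Icc a b) :=
      smoothCurveOn_smul (contDiffOn_affinePow hpos') α
    have hfull : ∀ t ∈ Icc a b, powerCurve α r q t ∈ fullRank I M n := fun t ht =>
      smul_mem_fullRank hα (affinePow_pos (hpos' t ht)).ne'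
    choose V hVc hV using fun i : M => hγ.exists_localVelocity hab i
    choose W hWc hW using fun i : M => hh.exists_localVelocity hab i
    refine (hasDerivAt_energy hab hγ hfull hh hVc hV hWc hW).congr_deriv
      (Finset.sum_eq_zero fun i _ => ?_)
    have hsub : Icc a b ×ˢ chartSupport I i ⊆ Icc a b ×ˢ (extChartAt I i).target :=
      prod_mono_right (chartSupport_subset I i)
    have hcV := continuous_columns.comp_continuousOn (hVc i)
    have hcW := continuous_columns.comp_continuousOn (hWc i)
    have hint : ContinuousOn (fun p : ℝ × EuclideanSpace ℝ (Fin m) => chartWeight I i p.2 *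
        metricVariation (coordMatrix I i p.2 fun x => powerCurve α r q p.1 x) (columns (V i p))
          (coordMatrix I i p.2 fun x => h p.1 x) (columns (W i p)))
        (Icc a b ×ˢ (extChartAt I i).target) :=
      ((continuousOn_chartWeight I i).comp continuousOn_snd fun p hp => hp.2).mul
        (continuousOn_metricVariation (hγ.continuousOn_coordMatrix i)
          (fun p hp => (det_gram_coordMatrix_pos (hfull p.1 hp.1) i hp.2).ne') hcV
          (hh.continuousOn_coordMatrix i) hcW)
    have hInt := (hint.mono hsub).integrableOn_compact
      (μ := (volume : Measure ℝ).prod (volume : Measure (EuclideanSpace ℝ (Fin m))))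
      (isCompact_Icc.prod (isCompact_chartSupport I i))
    rw [IntegrableOn, ← Measure.prod_restrict] at hInt
    -- Fubini puts the time integral inside. No derivative along `M` occurs, so each coordinate
    -- point `y` is treated separately, with its weight a constant.
    rw [← Measure.prod_restrict, integral_prod_symm _ hInt]
    refine setIntegral_eq_zero_of_forall_eq_zero fun y hy => ?_
    have hy' := chartSupport_subset I i hy
    have hslice : ContinuousOn (fun t : ℝ => (t, y)) (Icc a b) := by fun_prop
    have hmaps : MapsTo (fun t : ℝ => (t, y)) (Icc a b) (Icc a b ×ˢ (extChartAt I i).target) :=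
      fun t ht => ⟨ht, hy'⟩
    have hzero : ∀ t, h t = 0 → (coordMatrix I i y fun x => h t x) = 0 := fun t ht => by
      rw [ht]; rfl
    change ∫ t in Icc a b, chartWeight I i y * metricVariation (affinePow m r q t •
      coordMatrix I i y fun x => α x) (columns (V i (t, y))) (coordMatrix I i y fun x => h t x)
      (columns (W i (t, y))) = 0
    rw [integral_const_mul]
    refine mul_eq_zero_of_right _ (integral_variation_powerCurve_eq_zero hm hab hpos'
      (det_gram_coordMatrix_pos hα i hy').ne' (hcV.comp hslice hmaps) ?_
      ((hh.continuousOn_coordMatrix i).comp hslice hmaps) (hcW.comp hslice hmaps) ?_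
      (hzero a ha) (hzero b hb))
    · intro t ht
      have := (hV i t ht y hy').unique (hasDerivAt_localForm_powerCurve α
        (hpos' t (Ioo_subset_Icc_self ht)) i _)
      simp only [this, map_smul, coordMatrix_eq_columns i hy']
    · intro t ht
      simp only [coordMatrix_eq_columns i hy']
      exact hasDerivAt_columns (hW i t ht y hy')

end PowerCurve

/-! ### Volume against arc length -/

section Distance

attribute [local instance] Matrix.normedAddCommGroup Matrix.normedSpace

/-- Cauchy-Schwarz for the weight `ρ`, from expanding the nonnegative integral of `ρ * (τ - X / R) ^
2`, where `X / R` is the weighted mean of `τ`. -/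
theorem sq_setIntegral_mul_le {P : Type*} [TopologicalSpace P] [T2Space P] [MeasurableSpace P]
    [OpensMeasurableSpace P] {μ : Measure P} [IsFiniteMeasureOnCompacts μ] {K : Set P}
    (hK : IsCompact K) {ρ τ : P → ℝ} (hρ : ContinuousOn ρ K) (hτ : ContinuousOn τ K)
    (h0 : ∀ y ∈ K, 0 ≤ ρ y) (hpos : 0 < ∫ y in K, ρ y ∂μ) :
    (∫ y in K, ρ y * τ y ∂μ) ^ 2 ≤ (∫ y in K, ρ y ∂μ) * ∫ y in K, ρ y * τ y ^ 2 ∂μ := by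
  set R := ∫ y in K, ρ y ∂μ
  set X := ∫ y in K, ρ y * τ y ∂μ
  have h1 : 0 ≤ ∫ y in K, ρ y * (τ y - X / R) ^ 2 ∂μ :=
    setIntegral_nonneg hK.measurableSet fun y hy => mul_nonneg (h0 y hy) (sq_nonneg _)
  have i1 : IntegrableOn (fun y => ρ y * τ y ^ 2) K μ :=
    (hρ.mul (hτ.pow 2)).integrableOn_compact hK
  have i2 : IntegrableOn (fun y => ρ y * τ y) K μ := (hρ.mul hτ).integrableOn_compact hK
  have i3 : IntegrableOn ρ K μ := hρ.integrableOn_compact hK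
  have i4 : Integrable (fun y => ρ y * τ y ^ 2 - 2 * (X / R) * (ρ y * τ y)) (μ.restrict K) :=
    Integrable.sub i1 (i2.const_mul _)
  have h2 : ∫ y in K, ρ y * (τ y - X / R) ^ 2 ∂μ =
      (∫ y in K, ρ y * τ y ^ 2 ∂μ) - 2 * (X / R) * X + (X / R) ^ 2 * R := by
    rw [← integral_const_mul, ← integral_const_mul, ← integral_sub i1 (i2.const_mul _),
      ← integral_add i4 (i3.const_mul _)]
    refine integral_congr_ae (Eventually.of_forall fun y => ?_)
    ring
  rw [h2] at h1
  have h3 : (∫ y in K, ρ y * τ y ^ 2 ∂μ) - 2 * (X / R) * X + (X / R) ^ 2 * R =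
      (∫ y in K, ρ y * τ y ^ 2 ∂μ) - X ^ 2 / R := by
    field_simp
    ring
  rw [h3, sub_nonneg, div_le_iff₀ hpos] at h1
  linarith

variable {m : ℕ} {H : Type*} [TopologicalSpace H]
  {I : ModelWithCorners ℝ (EuclideanSpace ℝ (Fin m)) H}
  {M : Type*} [TopologicalSpace M] [ChartedSpace H M] [IsManifold I ∞ M] {n : ℕ}

theorem continuousOn_coordMatrix_const (α : OneForm I M n) (i : M) :
    ContinuousOn (fun y => coordMatrix I i y fun x => α x) (extChartAt I i).target := by
  have h := (smoothCurveOn_smul (φ := fun _ => 1) (J := univ) contDiffOn_const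
    α).continuousOn_coordMatrix i
  have h2 := h.comp (Continuous.prodMk_right (0 : ℝ)).continuousOn
    (fun y (hy : y ∈ (extChartAt I i).target) => ⟨mem_univ _, hy⟩)
  simpa [Function.comp_def] using h2

variable [T2Space M] [CompactSpace M]

/-- The part of the volume of `α` that is carried by the `i`-th function of the partition. -/
def chartVolume (i : M) (α : OneForm I M n) : ℝ :=
  ∫ y in chartSupport I i, chartWeight I i y * gramDensity (coordMatrix I i y fun x => α x)

theorem chartVolume_smul (i : M) (α : OneForm I M n) {f : ℝ} (hf : 0 < f) :
    chartVolume i (f • α) = f ^ m * chartVolume i α := by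
  rw [chartVolume, chartVolume, ← integral_const_mul]
  refine integral_congr_ae (Eventually.of_forall fun y => ?_)
  change chartWeight I i y * gramDensity (f • coordMatrix I i y fun x => α x) = _
  rw [gramDensity_smul hf]
  ring

/-- The point `x` may lie on the boundary, where its coordinate image has no neighbourhood inside
the chart target. But `range I` lies in the closure of its interior, so the positivity region still
contains a nonempty open set. -/
theorem chartVolume_pos {α : OneForm I M n} (hα : α ∈ fullRank I M n) {i x : M}
    (hx : 0 < chartPartition I M i x) : 0 < chartVolume i α := by
  have hD : ∀ y ∈ (extChartAt I i).target,
      0 < gramDensity (coordMatrix I i y fun x => α x) := fun y hy =>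
    Real.sqrt_pos.2 (det_gram_coordMatrix_pos hα i hy)
  have hcont : ContinuousOn (fun y => chartWeight I i y *
      gramDensity (coordMatrix I i y fun x => α x)) (chartSupport I i) :=
    ((continuousOn_chartWeight I i).mul (continuousOn_gramDensity
      (continuousOn_coordMatrix_const α i))).mono (chartSupport_subset I i)
  rw [chartVolume, setIntegral_pos_iff_support_of_nonneg_ae
    (Eventually.of_forall fun y => mul_nonneg (chartWeight_nonneg I i y) (gramDensity_nonneg _))
    (hcont.integrableOn_compact (isCompact_chartSupport I i))]
  set U : Set (EuclideanSpace ℝ (Fin m)) := I.symm ⁻¹' ((chartAt H i).target ∩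
    (chartAt H i).symm ⁻¹' {z | chartPartition I M i z ≠ 0})
  have hU : IsOpen U := ((chartAt H i).isOpen_inter_preimage_symm
    (isOpen_ne_fun (chartPartition I M i).contMDiff.continuous continuous_const)).preimage
    I.continuous_symm
  have hUs : U ∩ range I ⊆ Function.support (fun y => chartWeight I i y *
      gramDensity (coordMatrix I i y fun x => α x)) ∩ chartSupport I i := by
    rintro y ⟨hy, hyr⟩
    have hyt : y ∈ (extChartAt I i).target := by
      rw [extChartAt_target]; exact ⟨hy.1, hyr⟩
    have hw : chartWeight I i y ≠ 0 := hy.2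
    refine ⟨mul_ne_zero hw (hD y hyt).ne', ?_⟩
    by_contra h
    exact hw (chartWeight_eq_zero I i hyt h)
  have hxs : x ∈ (extChartAt I i).source :=
    tsupport_chartPartition_subset I i (subset_tsupport _ hx.ne')
  have hxU : extChartAt I i x ∈ U := by
    have h1 := (extChartAt I i).map_source hxs
    rw [extChartAt_target] at h1
    refine ⟨h1.1, ?_⟩
    have h2 : (chartAt H i).symm (I.symm (extChartAt I i x)) = x := (extChartAt I i).left_inv hxs
    change chartPartition I M i ((chartAt H i).symm (I.symm (extChartAt I i x))) ≠ 0
    rw [h2]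
    exact hx.ne'
  have hcl : extChartAt I i x ∈ closure (interior (range I)) :=
    I.range_subset_closure_interior (extChartAt_target_subset_range i
      ((extChartAt I i).map_source hxs))
  have hne : (U ∩ interior (range I)).Nonempty := mem_closure_iff.1 hcl U hU hxU
  exact ((hU.inter isOpen_interior).measure_pos volume hne).trans_le
    (measure_mono ((inter_subset_inter_right U interior_subset).trans hUs))

/-- All terms are nonnegative, so a single chart already bounds the metric from below. -/
theorem ebinMetric_nonneg_term_le (α ζ : ∀ x, FormFibre I M n x) {i : M}
    (hi : i ∈ chartIndices I) :
    ∫ y in chartSupport I i, chartWeight I i y *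
      matrixMetric (coordMatrix I i y α) (coordMatrix I i y ζ) (coordMatrix I i y ζ) ≤
      ebinMetric I α ζ ζ := by
  rw [ebinMetric_eq_sum]
  exact Finset.single_le_sum (f := fun i => ∫ y in chartSupport I i, chartWeight I i y *
      matrixMetric (coordMatrix I i y α) (coordMatrix I i y ζ) (coordMatrix I i y ζ))
    (fun j _ => integral_nonneg fun y =>
      mul_nonneg (chartWeight_nonneg I j y) (matrixMetric_self_nonneg _ _)) hi

/-- The speed is integrable along a smooth curve, and the square root of the volume is Lipschitz
with respect to arc length. -/
theorem sqrt_chartVolume_sub_le (hm : 0 < m) {γ : ℝ → OneForm I M n} {a b : ℝ} (hab : a ≤ b)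
    (hγ : SmoothCurveOn I γ (Icc a b)) (hfull : ∀ t ∈ Icc a b, γ t ∈ fullRank I M n)
    {i x : M} (hx : 0 < chartPartition I M i x) :
    IntervalIntegrable (fun t => Real.sqrt (ebinMetric I (fun x => γ t x) (velocity γ t)
      (velocity γ t))) volume a b ∧
    Real.sqrt (chartVolume i (γ b)) - Real.sqrt (chartVolume i (γ a)) ≤
      Real.sqrt m / 2 * length γ a b := by
  rcases hab.eq_or_lt with rfl | hab
  · simp [length]
  have hi : i ∈ chartIndices I := by
    simp only [chartIndices, Finite.mem_toFinset, mem_ofPred_eq]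
    exact ⟨x, hx.ne'⟩
  choose V hVc hV using fun i : M => hγ.exists_localVelocity hab i
  have hvel : ∀ j : M, ∀ t ∈ Ioo a b, ∀ y ∈ (extChartAt I j).target,
      coordMatrix I j y (velocity γ t) = columns (V j (t, y)) := fun j t ht y hy =>
    coordMatrix_velocity j hy (hV j t ht y hy)
  have hsub : ∀ j : M, Icc a b ×ˢ chartSupport I j ⊆ Icc a b ×ˢ (extChartAt I j).target :=
    fun j => prod_mono_right (chartSupport_subset I j)
  have hA : ∀ j : M, ContinuousOn (fun p : ℝ × EuclideanSpace ℝ (Fin m) =>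
      coordMatrix I j p.2 fun x => γ p.1 x) (Icc a b ×ˢ chartSupport I j) := fun j =>
    (hγ.continuousOn_coordMatrix j).mono (hsub j)
  have hVm : ∀ j : M, ContinuousOn (fun p => columns (V j p)) (Icc a b ×ˢ chartSupport I j) :=
    fun j => continuous_columns.comp_continuousOn ((hVc j).mono (hsub j))
  have hw : ∀ j : M, ContinuousOn (fun p : ℝ × EuclideanSpace ℝ (Fin m) => chartWeight I j p.2)
      (Icc a b ×ˢ chartSupport I j) := fun j =>
    ((continuousOn_chartWeight I j).mono (chartSupport_subset I j)).comp continuousOn_snd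
      fun p hp => hp.2
  have hdet : ∀ j : M, ∀ p ∈ Icc a b ×ˢ chartSupport I j,
      0 < ((coordMatrix I j p.2 fun x => γ p.1 x)ᵀ * coordMatrix I j p.2 fun x => γ p.1 x).det :=
    fun j p hp => det_gram_coordMatrix_pos (hfull p.1 hp.1) j (hsub j hp).2
  set S : ℝ → ℝ := fun t => Real.sqrt (ebinMetric I (fun x => γ t x) (velocity γ t)
    (velocity γ t)) with hS
  have hSint : IntegrableOn S (Icc a b) := by
    have hc : ContinuousOn (fun t => Real.sqrt (∑ j ∈ chartIndices I,
        ∫ y in chartSupport I j, chartWeight I j y *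
          matrixMetric (coordMatrix I j y fun x => γ t x) (columns (V j (t, y)))
            (columns (V j (t, y))))) (Icc a b) :=
      (continuousOn_finsetSum _ fun j _ => continuousOn_setIntegral_of_isCompact
        (Φ := fun t y => chartWeight I j y * matrixMetric (coordMatrix I j y fun x => γ t x)
          (columns (V j (t, y))) (columns (V j (t, y)))) (isCompact_chartSupport I j)
        ((hw j).mul (continuousOn_matrixMetric (hA j) (fun p hp => (hdet j p hp).ne')
          (hVm j) (hVm j)))).sqrt
    have hc' := hc.integrableOn_compact (μ := volume) isCompact_Icc
    -- The speed agrees with its continuous coordinate expression only in the open interval, because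
    -- the velocity is two-sided.
    rw [integrableOn_Icc_iff_integrableOn_Ioo] at hc' ⊢
    refine hc'.congr_fun (fun t ht => ?_) measurableSet_Ioo
    simp only [hS]
    rw [ebinMetric_eq_sum]
    congr 1
    refine Finset.sum_congr rfl fun j _ =>
      setIntegral_congr_fun (isCompact_chartSupport I j).measurableSet fun y hy => ?_
    simp only [hvel j t ht y (chartSupport_subset I j hy)]
  refine ⟨(intervalIntegrable_iff_integrableOn_Icc_of_le hab.le).2 hSint, ?_⟩
  have hVolc : ContinuousOn (fun t => chartVolume i (γ t)) (Icc a b) :=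
    continuousOn_setIntegral_of_isCompact (isCompact_chartSupport I i)
      (Φ := fun t y => chartWeight I i y * gramDensity (coordMatrix I i y fun x => γ t x))
      ((hw i).mul (continuousOn_gramDensity (hA i)))
  have hVold : ∀ t ∈ Ioo a b, HasDerivAt (fun t => chartVolume i (γ t))
      (∫ y in chartSupport I i, chartWeight I i y *
        (gramPairing (coordMatrix I i y fun x => γ t x) (coordMatrix I i y fun x => γ t x)
          (columns (V i (t, y))) * gramDensity (coordMatrix I i y fun x => γ t x))) t := by
    intro t ht
    refine hasDerivAt_setIntegral_of_isCompact (isCompact_chartSupport I i)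
      (Φ := fun t y => chartWeight I i y * gramDensity (coordMatrix I i y fun x => γ t x))
      (Φ' := fun t y => chartWeight I i y *
        (gramPairing (coordMatrix I i y fun x => γ t x) (coordMatrix I i y fun x => γ t x)
          (columns (V i (t, y))) * gramDensity (coordMatrix I i y fun x => γ t x)))
      ((hw i).mul (continuousOn_gramDensity (hA i)))
      ((hw i).mul ((continuousOn_gramPairing (hA i) (fun p hp => (hdet i p hp).ne') (hA i)
        (hVm i)).mul (continuousOn_gramDensity (hA i)))) ?_ ht
    intro τ hτ y hy
    have hy' := chartSupport_subset I i hy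
    have hd : HasDerivAt (fun τ => coordMatrix I i y fun x => γ τ x) (columns (V i (τ, y))) τ := by
      simp only [coordMatrix_eq_columns i hy']
      exact hasDerivAt_columns (hV i τ hτ y hy')
    exact (hasDerivAt_gramDensity hd (hdet i (τ, y) ⟨Ioo_subset_Icc_self hτ, hy⟩)).const_mul _
  have hslice : ∀ t ∈ Icc a b, ∀ {Z : ℝ × EuclideanSpace ℝ (Fin m) → ℝ},
      ContinuousOn Z (Icc a b ×ˢ chartSupport I i) →
      ContinuousOn (fun y => Z (t, y)) (chartSupport I i) := fun t ht Z hZ =>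
    hZ.comp (Continuous.prodMk_right t).continuousOn fun y hy => ⟨ht, hy⟩
  have hbound : ∀ t ∈ Ioo a b, (∫ y in chartSupport I i, chartWeight I i y *
        (gramPairing (coordMatrix I i y fun x => γ t x) (coordMatrix I i y fun x => γ t x)
          (columns (V i (t, y))) * gramDensity (coordMatrix I i y fun x => γ t x))) ≤
      Real.sqrt (chartVolume i (γ t)) * (Real.sqrt m * S t) := by
    intro t ht
    have ht' := Ioo_subset_Icc_self ht
    have hpos := chartVolume_pos (hfull t ht') hx
    have hρc : ContinuousOn (fun p : ℝ × EuclideanSpace ℝ (Fin m) => chartWeight I i p.2 *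
        gramDensity (coordMatrix I i p.2 fun x => γ p.1 x)) (Icc a b ×ˢ chartSupport I i) :=
      (hw i).mul (continuousOn_gramDensity (hA i))
    have hτc := continuousOn_gramPairing (hA i) (fun p hp => (hdet i p hp).ne') (hA i) (hVm i)
    have hmc := continuousOn_gramPairing (hA i) (fun p hp => (hdet i p hp).ne') (hVm i) (hVm i)
    have hK := isCompact_chartSupport I i
    have h1 := sq_setIntegral_mul_le (μ := volume) hK (hslice t ht' hρc) (hslice t ht' hτc)
      (fun y _ => mul_nonneg (chartWeight_nonneg I i y) (gramDensity_nonneg _)) hpos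
    have h2 : (∫ y in chartSupport I i, chartWeight I i y *
        gramDensity (coordMatrix I i y fun x => γ t x) *
        gramPairing (coordMatrix I i y fun x => γ t x) (coordMatrix I i y fun x => γ t x)
          (columns (V i (t, y))) ^ 2) ≤
        m * ebinMetric I (fun x => γ t x) (velocity γ t) (velocity γ t) := by
      refine le_trans ?_ (mul_le_mul_of_nonneg_left
        (ebinMetric_nonneg_term_le (fun x => γ t x) (velocity γ t) hi) (by positivity))
      have e : ∫ y in chartSupport I i, chartWeight I i y * matrixMetric
          (coordMatrix I i y fun x => γ t x) (coordMatrix I i y (velocity γ t))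
          (coordMatrix I i y (velocity γ t)) =
          ∫ y in chartSupport I i, chartWeight I i y * matrixMetric
          (coordMatrix I i y fun x => γ t x) (columns (V i (t, y))) (columns (V i (t, y))) :=
        setIntegral_congr_fun hK.measurableSet fun y hy => by
          simp only [hvel i t ht y (chartSupport_subset I i hy)]
      rw [e, ← integral_const_mul]
      refine setIntegral_mono_on
        ((hslice t ht' (hρc.mul (hτc.pow 2))).integrableOn_compact hK) ?_ hK.measurableSet ?_
      · exact (hslice t ht' (((hw i).mul (hmc.mul (continuousOn_gramDensity
          (hA i)))).const_smul (m : ℝ))).integrableOn_compact hK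
      · intro y hy
        have h3 := mul_le_mul_of_nonneg_left
          (gramPairing_base_sq_le hm (hdet i (t, y) ⟨ht', hy⟩).ne' (columns (V i (t, y))))
          (mul_nonneg (chartWeight_nonneg I i y)
            (gramDensity_nonneg (coordMatrix I i y fun x => γ t x)))
        refine h3.trans_eq ?_
        rw [matrixMetric_eq]
        ring
    have h4 : (∫ y in chartSupport I i, chartWeight I i y *
        (gramPairing (coordMatrix I i y fun x => γ t x) (coordMatrix I i y fun x => γ t x)
          (columns (V i (t, y))) * gramDensity (coordMatrix I i y fun x => γ t x))) ^ 2 ≤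
        chartVolume i (γ t) *
          (m * ebinMetric I (fun x => γ t x) (velocity γ t) (velocity γ t)) := by
      refine le_trans (le_of_eq ?_) (h1.trans (mul_le_mul_of_nonneg_left h2 hpos.le))
      congr 1
      refine integral_congr_ae (Eventually.of_forall fun y => ?_)
      ring
    rw [hS, ← Real.sqrt_mul (by positivity), ← Real.sqrt_mul hpos.le]
    exact Real.le_sqrt_of_sq_le h4
  -- Dividing `hbound` by `2 √Vol` bounds the derivative of `√Vol` by `√m / 2` times the speed;
  -- integration gives the claim.
  have hmain := intervalIntegral.sub_le_integral_of_hasDeriv_right_of_le hab.le hVolc.sqrt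
    (fun t ht => ((hVold t ht).sqrt
      (chartVolume_pos (hfull t (Ioo_subset_Icc_self ht)) hx).ne').hasDerivWithinAt)
    (hSint.const_mul (Real.sqrt m / 2)) (fun t ht => by
      have hp := Real.sqrt_pos.2 (chartVolume_pos (hfull t (Ioo_subset_Icc_self ht)) hx)
      rw [div_le_iff₀ (by positivity)]
      refine (hbound t ht).trans_eq ?_
      ring)
  rwa [intervalIntegral.integral_const_mul] at hmain

end Distance

/-! ### Cauchy sequences without limit and geodesics that cannot be extended -/

section Incompleteness

attribute [local instance] Matrix.normedAddCommGroup Matrix.normedSpace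

variable {m : ℕ} {H : Type*} [TopologicalSpace H]
  {I : ModelWithCorners ℝ (EuclideanSpace ℝ (Fin m)) H}
  {M : Type*} [TopologicalSpace M] [ChartedSpace H M] [IsManifold I ∞ M] {n : ℕ}

theorem velocity_scalingCurve_zero (hm : 0 < m) (α : OneForm I M n) (c : ℝ) :
    velocity (scalingCurve α c) 0 = fun x => c • α x := by
  funext x
  have h1 := hasDerivAt_affinePow (m := m) (r := 1) (q := c * m / 2) (t := 0) (by simp)
  have hm' : (m : ℝ) ≠ 0 := by positivity
  have e : 2 * (c * m / 2) / m * (affinePow m 1 (c * m / 2) 0 / (1 + c * m / 2 * 0)) = c := by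
    simp only [affinePow, mul_zero, add_zero, Real.one_rpow]
    field_simp
  rw [e] at h1
  have h2 := h1.smul_const
    (show EuclideanSpace ℝ (Fin m) →L[ℝ] EuclideanSpace ℝ (Fin n) from α x)
  rw [scalingCurve_eq_powerCurve]
  exact HasDerivAt.deriv (F := EuclideanSpace ℝ (Fin m) →L[ℝ] EuclideanSpace ℝ (Fin n)) h2

variable [T2Space M] [CompactSpace M]

/-- Induction over the break points. Integrability of the speed is carried along because additivity
of length needs it. -/
theorem IsPath.sqrt_chartVolume_le (hm : 0 < m) {γ : ℝ → OneForm I M n} {α β : OneForm I M n}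
    (hγ : IsPath γ α β) {i x : M} (hx : 0 < chartPartition I M i x) :
    Real.sqrt (chartVolume i β) ≤
      Real.sqrt (chartVolume i α) + Real.sqrt m / 2 * length γ 0 1 := by
  obtain ⟨k, p, hp, hp0, hpk, hs⟩ := hγ.piecewise_smooth
  have key : ∀ j ≤ k, IntervalIntegrable (fun t => Real.sqrt (ebinMetric I (fun x => γ t x)
      (velocity γ t) (velocity γ t))) volume (p 0) (p j) ∧
      Real.sqrt (chartVolume i (γ (p j))) - Real.sqrt (chartVolume i (γ (p 0))) ≤
        Real.sqrt m / 2 * length γ (p 0) (p j) := by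
    intro j
    induction j with
    | zero => intro _; simp [length]
    | succ j ih =>
      intro hj
      obtain ⟨ih1, ih2⟩ := ih (by omega)
      obtain ⟨h1, h2⟩ := sqrt_chartVolume_sub_le hm (hp (Nat.le_succ j)) (hs j (by omega))
        (fun t ht => hγ.mem_fullRank t
          ⟨(hp0 ▸ hp (Nat.zero_le j)).trans ht.1, ht.2.trans (hpk ▸ hp hj)⟩) hx
      refine ⟨ih1.trans h1, ?_⟩
      have h3 : length γ (p 0) (p (j + 1)) = length γ (p 0) (p j) + length γ (p j) (p (j + 1)) :=
        (intervalIntegral.integral_add_adjacent_intervals ih1 h1).symm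
      rw [h3]
      linarith
  have h := (key k le_rfl).2
  rw [hp0, hpk, hγ.source, hγ.target] at h
  linarith

theorem sqrt_chartVolume_le_of_geodesicDist_lt (hm : 0 < m) {α β : OneForm I M n} {ε : ℝ}
    (h : geodesicDist α β < ENNReal.ofReal ε) {i x : M} (hx : 0 < chartPartition I M i x) :
    Real.sqrt (chartVolume i β) ≤ Real.sqrt (chartVolume i α) + Real.sqrt m / 2 * ε := by
  simp only [geodesicDist, iInf_lt_iff] at h
  obtain ⟨γ, hγ, hl⟩ := h
  have hl' : length γ 0 1 < ε := (ENNReal.ofReal_lt_ofReal_iff_of_nonneg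
    (intervalIntegral.integral_nonneg zero_le_one fun t _ => Real.sqrt_nonneg _)).1 hl
  refine (hγ.sqrt_chartVolume_le hm hx).trans ?_
  gcongr

/-- The ray has constant speed: the factors `f ^ m = ρ ^ 2` and `(f' / f) ^ 2 = (2 q / m) ^ 2 / ρ ^
2` multiply to a constant. -/
theorem ebinMetric_powerCurve (hm : 0 < m) {α : OneForm I M n} (hα : α ∈ fullRank I M n)
    {r q t : ℝ} (h : 0 < r + q * t) :
    ebinMetric I (fun x => powerCurve α r q t x) (velocity (powerCurve α r q) t)
        (velocity (powerCurve α r q) t) =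
      (2 * q / m) ^ 2 * ebinMetric I (fun x => α x) (fun x => α x) (fun x => α x) := by
  rw [ebinMetric_eq_sum, ebinMetric_eq_sum, Finset.mul_sum]
  refine Finset.sum_congr rfl fun i _ => ?_
  rw [← integral_const_mul]
  refine setIntegral_congr_fun (isCompact_chartSupport I i).measurableSet fun y hy => ?_
  have hy' := chartSupport_subset I i hy
  have hf := affinePow_pos (m := m) h
  have e1 := coordMatrix_velocity i hy' (hasDerivAt_localForm_powerCurve α h i _)
  rw [map_smul, ← coordMatrix_eq_columns i hy' fun x => α x] at e1
  have e2 : (coordMatrix I i y fun x => powerCurve α r q t x) =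
    affinePow m r q t • coordMatrix I i y fun x => α x := rfl
  simp only [e1, e2]
  rw [matrixMetric_smul hf (det_gram_coordMatrix_pos hα i hy').ne', affinePow_pow hm h]
  field_simp

/-- The endpoints are the forms with `ρ = r` and `ρ = s`, written with slope `0`; the ray with slope
`s - r` joins them in unit time at constant speed. -/
theorem geodesicDist_powerCurve_le (hm : 0 < m) {α : OneForm I M n} (hα : α ∈ fullRank I M n)
    {r s : ℝ} (hr : 0 < r) (hs : 0 < s) :
    geodesicDist (powerCurve α r 0 0) (powerCurve α s 0 0) ≤ ENNReal.ofReal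
      (|s - r| * (2 / m * Real.sqrt (ebinMetric I (fun x => α x) (fun x => α x) fun x => α x))) := by
  have hpos : ∀ t ∈ Icc (0 : ℝ) 1, 0 < r + (s - r) * t := fun t ht => by
    have h1 : r + (s - r) * t = r * (1 - t) + s * t := by ring
    rw [h1]
    rcases ht.1.eq_or_lt with rfl | h0
    · simpa using hr
    · have := mul_pos hs h0
      have := mul_nonneg hr.le (sub_nonneg.2 ht.2)
      linarith
  have hpath : IsPath (powerCurve α r (s - r)) (powerCurve α r 0 0) (powerCurve α s 0 0) :=
    { mem_fullRank := fun t ht => smul_mem_fullRank hα (affinePow_pos (hpos t ht)).ne'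
      piecewise_smooth := by
        -- One smooth piece; the minimum keeps the sequence of break points at `1` afterwards.
        refine ⟨1, fun j => min (j : ℝ) 1, fun a b hab => ?_, by simp, by simp, fun j hj => ?_⟩
        · exact min_le_min_right _ (by exact_mod_cast hab)
        · obtain rfl : j = 0 := by omega
          have h : SmoothCurveOn I (powerCurve α r (s - r)) (Icc 0 1) :=
            smoothCurveOn_smul (contDiffOn_affinePow hpos) α
          simpa using h
      source := by simp [powerCurve, affinePow]
      target := by simp [powerCurve, affinePow] }
  refine (iInf₂_le (powerCurve α r (s - r)) hpath).trans (le_of_eq ?_)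
  congr 1
  have hcongr : EqOn (fun t => Real.sqrt (ebinMetric I (fun x => powerCurve α r (s - r) t x)
      (velocity (powerCurve α r (s - r)) t) (velocity (powerCurve α r (s - r)) t)))
      (fun _ => |s - r| * (2 / m * Real.sqrt
        (ebinMetric I (fun x => α x) (fun x => α x) fun x => α x))) (uIcc 0 1) := by
    intro t ht
    rw [uIcc_of_le zero_le_one] at ht
    simp only
    rw [ebinMetric_powerCurve hm hα (hpos t ht), Real.sqrt_mul (sq_nonneg _), Real.sqrt_sq_eq_abs,
      abs_div, abs_mul, Nat.abs_cast, Nat.abs_ofNat]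
    ring
  rw [length, intervalIntegral.integral_congr hcongr]
  simp

theorem not_metricallyComplete (hm : 0 < m) [Nonempty M] (hne : (fullRank I M n).Nonempty) :
    ¬ MetricallyComplete I M n := by
  intro hc
  obtain ⟨α, hα⟩ := hne
  have hpos : ∀ k : ℕ, (0 : ℝ) < 1 / ((k : ℝ) + 1) := fun k => Nat.one_div_pos_of_nat
  have hpos' : ∀ k : ℕ, (0 : ℝ) < 1 / ((k : ℝ) + 1) + 0 * 0 := fun k => by simpa using hpos k
  set u : ℕ → OneForm I M n := fun k => powerCurve α (1 / ((k : ℝ) + 1)) 0 0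
  set C := 2 / m * Real.sqrt (ebinMetric I (fun x => α x) (fun x => α x) fun x => α x)
  have hlim := tendsto_one_div_add_atTop_nhds_zero_nat (𝕜 := ℝ)
  obtain ⟨β, hβ, hβlim⟩ := hc u
    (fun k => smul_mem_fullRank hα (affinePow_pos (hpos' k)).ne') (fun ε hε => by
      have h1 : Tendsto (fun k : ℕ => ENNReal.ofReal (1 / ((k : ℝ) + 1) * C)) atTop (𝓝 0) := by
        have := ENNReal.tendsto_ofReal (hlim.mul_const C)
        simpa using this
      obtain ⟨N, hN⟩ := (h1.eventually (gt_mem_nhds hε)).exists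
      refine ⟨N, fun k hk l hl => ?_⟩
      refine (geodesicDist_powerCurve_le hm hα (hpos k) (hpos l)).trans_lt
        (lt_of_le_of_lt (ENNReal.ofReal_le_ofReal ?_) hN)
      refine mul_le_mul_of_nonneg_right ?_ (by positivity)
      have hk' : 1 / ((k : ℝ) + 1) ≤ 1 / ((N : ℝ) + 1) := Nat.one_div_le_one_div hk
      have hl' : 1 / ((l : ℝ) + 1) ≤ 1 / ((N : ℝ) + 1) := Nat.one_div_le_one_div hl
      rw [abs_le]
      constructor <;> linarith [hpos k, hpos l])
  obtain ⟨x⟩ := ‹Nonempty M›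
  obtain ⟨i, hx⟩ := (chartPartition I M).exists_pos_of_mem (mem_univ x)
  have hvol : ∀ k : ℕ, Real.sqrt (chartVolume i (u k)) =
      1 / ((k : ℝ) + 1) * Real.sqrt (chartVolume i α) := fun k => by
    rw [show u k = affinePow m (1 / ((k : ℝ) + 1)) 0 0 • α from rfl,
      chartVolume_smul i α (affinePow_pos (hpos' k)), affinePow_pow hm (hpos' k), zero_mul, add_zero,
      Real.sqrt_mul (sq_nonneg _), Real.sqrt_sq (hpos k).le]
  have hvollim : Tendsto (fun k => Real.sqrt (chartVolume i (u k))) atTop (𝓝 0) := by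
    simp only [hvol]
    simpa using hlim.mul_const (Real.sqrt (chartVolume i α))
  have hle : ∀ ε : ℝ, 0 < ε → Real.sqrt (chartVolume i β) ≤ 0 + Real.sqrt m / 2 * ε := fun ε hε =>
    ge_of_tendsto (hvollim.add_const (Real.sqrt m / 2 * ε))
      ((hβlim.eventually (gt_mem_nhds (ENNReal.ofReal_pos.2 hε))).mono fun k hk =>
        sqrt_chartVolume_le_of_geodesicDist_lt hm hk hx)
  have hβpos := Real.sqrt_pos.2 (chartVolume_pos hβ hx)
  have hm' : 0 < Real.sqrt m := Real.sqrt_pos.2 (by exact_mod_cast hm)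
  -- This `ε` turns the bound into `√Vol ≤ √Vol / 2`, impossible for positive volume.
  have h := hle (Real.sqrt (chartVolume i β) / Real.sqrt m) (by positivity)
  have h' : 0 + Real.sqrt m / 2 * (Real.sqrt (chartVolume i β) / Real.sqrt m) =
    Real.sqrt (chartVolume i β) / 2 := by field_simp; ring
  linarith

/-! ### Behaviour at the terminal time -/

section Scaling

variable {c : ℝ}

theorem scaling_affine_pos (hm : 0 < m) (hc : c < 0) {t : ℝ} (ht : t < 2 / (|c| * m)) :
    0 < 1 + c * m / 2 * t := by
  rw [abs_of_neg hc, lt_div_iff₀ (mul_pos (neg_pos.2 hc) (by exact_mod_cast hm))] at ht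
  linarith

theorem scaling_affine_eq_zero (hm : 0 < m) (hc : c < 0) :
    1 + c * m / 2 * (2 / (|c| * m)) = 0 := by
  have hm' : (m : ℝ) ≠ 0 := by positivity
  rw [abs_of_neg hc]
  field_simp [hc.ne]
  ring

theorem tendsto_scaling_factor (hm : 0 < m) (hc : c < 0) :
    Tendsto (affinePow m 1 (c * m / 2)) (𝓝 (2 / (|c| * m))) (𝓝 0) := by
  have hm' : (0 : ℝ) < 2 / m := by positivity
  have h1 : Tendsto (fun t => 1 + c * m / 2 * t) (𝓝 (2 / (|c| * m))) (𝓝 0) := by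
    rw [← scaling_affine_eq_zero hm hc]
    exact Continuous.tendsto (by fun_prop) _
  have h2 := h1.rpow_const (p := 2 / (m : ℝ)) (Or.inr hm'.le)
  rwa [Real.zero_rpow hm'.ne'] at h2

theorem not_isGeodesicOn_of_eqOn_scalingCurve (hm : 0 < m) [Nonempty M] {α : OneForm I M n}
    (hc : c < 0) {b : ℝ} {σ : ℝ → OneForm I M n} (hb : 2 / (|c| * m) < b)
    (hσ : EqOn σ (scalingCurve α c) (Ico 0 (2 / (|c| * m)))) : ¬ IsGeodesicOn σ (Ico 0 b) := by
  intro hg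
  set T := 2 / (|c| * m)
  have hT : 0 < T := by
    have : 0 < |c| := abs_pos.2 hc.ne
    positivity
  obtain ⟨x⟩ := ‹Nonempty M›
  have hx := mem_extChartAt_source (I := I) x
  have hy := (extChartAt I x).map_source hx
  have h1 := (hg.smooth.contDiffOn_localForm x).continuousOn.comp
    (Continuous.prodMk_left (extChartAt I x x)).continuousOn
    (fun t (ht : t ∈ Ico 0 b) => ⟨ht, hy⟩)
  have h2 : Tendsto (fun t => localForm I x x (σ t x)) (𝓝[Ico 0 T] T)
      (𝓝 (localForm I x x (σ T x))) := by
    have h3 := (h1 T ⟨hT.le, hb⟩).mono (Ico_subset_Ico_right hb.le)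
    -- The chart returns a point only propositionally equal to `x`, and the fibres depend on it, so
    -- the limit is transported along the equality.
    have h4 : ∀ z, z = x → Tendsto (fun t => localForm I x z (σ t z)) (𝓝[Ico 0 T] T)
        (𝓝 (localForm I x z (σ T z))) → Tendsto (fun t => localForm I x x (σ t x))
        (𝓝[Ico 0 T] T) (𝓝 (localForm I x x (σ T x))) := by
      rintro z rfl h
      exact h
    exact h4 _ ((extChartAt I x).left_inv hx) h3.tendsto
  have h4 : Tendsto (fun t => localForm I x x (σ t x)) (𝓝[Ico 0 T] T) (𝓝 0) := by
    have h5 := ((tendsto_scaling_factor hm hc).mono_left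
      (nhdsWithin_le_nhds (s := Ico 0 T))).smul_const (localForm I x x (α x))
    have e : (0 : ℝ) • localForm I x x (α x) = 0 :=
      zero_smul ℝ (localForm I x x (α x))
    rw [← e]
    refine h5.congr' (eventually_mem_nhdsWithin.mono fun t ht => ?_)
    simp only [hσ ht, scalingCurve_eq_powerCurve]
    exact (map_smul (localForm I x x) _ (α x)).symm
  have hne : (𝓝[Ico 0 T] T).NeBot := by
    rw [← mem_closure_iff_nhdsWithin_neBot, closure_Ico hT.ne]
    exact ⟨hT.le, le_rfl⟩
  have h6 := tendsto_nhds_unique h2 h4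
  have h7 : σ T x = 0 := by
    rw [← ofLocalForm_localForm (mem_chart_source H x) (σ T x), h6, map_zero]
  have hinj := hg.mem_fullRank T ⟨hT.le, hb⟩ x
  -- Since `m > 0` there is a nonzero tangent vector, and the vanishing form at time `T` sends it to
  -- `0`, against injectivity.
  have hv : (EuclideanSpace.single (⟨0, hm⟩ : Fin m) (1 : ℝ) : TangentSpace I x) = 0 := by
    apply hinj
    rw [h7]
    rfl
  simpa using congrArg (fun v : EuclideanSpace ℝ (Fin m) => v ⟨0, hm⟩) hv

end Scaling

theorem IsGeodesicOn.mono {γ : ℝ → OneForm I M n} {J K : Set ℝ} (h : IsGeodesicOn γ J)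
    (hK : K ⊆ J) : IsGeodesicOn γ K where
  smooth := ContMDiffOn.mono h.smooth (prod_mono_left hK)
  mem_fullRank t ht := h.mem_fullRank t (hK ht)
  critical a b hab hJ := h.critical a b hab (hJ.trans hK)

theorem isGeodesicOn_scalingCurve (hm : 0 < m) {α : OneForm I M n} (hα : α ∈ fullRank I M n)
    {c : ℝ} (hc : c < 0) : IsGeodesicOn (scalingCurve α c) (Iio (2 / (|c| * m))) := by
  rw [scalingCurve_eq_powerCurve]
  exact isGeodesicOn_powerCurve hm hα fun t ht => scaling_affine_pos hm hc ht

theorem not_geodesicallyComplete (hm : 0 < m) [Nonempty M] (hne : (fullRank I M n).Nonempty) :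
    ¬ GeodesicallyComplete I M n := by
  intro hcomp
  obtain ⟨α, hα⟩ := hne
  have hc : (-1 : ℝ) < 0 := by norm_num
  -- Any negative `c` would do; a complete extension would in particular be a geodesic up to one
  -- unit past the terminal time.
  obtain ⟨σ, hσ, hEq⟩ := hcomp _ _ isOpen_Iio ordConnected_Iio (isGeodesicOn_scalingCurve hm hα hc)
  exact not_isGeodesicOn_of_eqOn_scalingCurve hm hc (lt_add_one _)
    (hEq.mono Ico_subset_Iio_self) (hσ.mono (subset_univ _))

end Incompleteness

end EbinForms

end

theorem mainTheorem10 {m n : ℕ} (hm : 0 < m) (hmn : m ≤ n)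
    {H : Type*} [TopologicalSpace H] (I : ModelWithCorners ℝ (EuclideanSpace ℝ (Fin m)) H)
    (M : Type*) [TopologicalSpace M] [ChartedSpace H M] [IsManifold I ∞ M]
    [T2Space M] [CompactSpace M] [Nonempty M]
    (hne : (EbinForms.fullRank I M n).Nonempty) :
    ¬ EbinForms.GeodesicallyComplete I M n ∧
    ¬ EbinForms.MetricallyComplete I M n ∧
    ∀ α ∈ EbinForms.fullRank I M n, ∀ c : ℝ, c < 0 →
      EbinForms.IsGeodesicOn (EbinForms.scalingCurve α c) (Iio (2 / (|c| * m))) ∧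
      EbinForms.scalingCurve α c 0 = α ∧
      EbinForms.velocity (EbinForms.scalingCurve α c) 0 = (fun x => c • α x) ∧
      (∀ (x : M) (v : TangentSpace I x),
        Tendsto (fun t => EbinForms.scalingCurve α c t x v) (𝓝[<] (2 / (|c| * m))) (𝓝 0)) ∧
      ∀ (b : ℝ) (σ : ℝ → EbinForms.OneForm I M n), 2 / (|c| * m) < b →
        EqOn σ (EbinForms.scalingCurve α c) (Ico 0 (2 / (|c| * m))) →
        ¬ EbinForms.IsGeodesicOn σ (Ico 0 b) := by
  refine ⟨EbinForms.not_geodesicallyComplete hm hne, EbinForms.not_metricallyComplete hm hne,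
    fun α hα c hc => ⟨EbinForms.isGeodesicOn_scalingCurve hm hα hc, ?_,
      EbinForms.velocity_scalingCurve_zero hm α c, fun x v => ?_,
      fun b σ hb hσ => EbinForms.not_isGeodesicOn_of_eqOn_scalingCurve hm hc hb hσ⟩⟩
  · simp [EbinForms.scalingCurve]
  · have h := ((EbinForms.tendsto_scaling_factor hm hc).mono_left
      (nhdsWithin_le_nhds (s := Iio (2 / (|c| * m))))).smul_const
      (show EuclideanSpace ℝ (Fin n) from α x v)
    rw [zero_smul] at h
    rw [EbinForms.scalingCurve_eq_powerCurve]
    exact h
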